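/- Let $\Gamma\subset PSL(2,\mathbb Z)$ be the Farey group, i.e. the subgroup generated by the classes of $$a=\begin{pmatrix}1&-2\\1&-1\end{pmatrix},\qquad b=\begin{pmatrix}0&-1\\1&0\end{pmatrix},\qquad c=\begin{pmatrix}1&-1\\2&-1\end{pmatrix},$$ acting on the projective line $X=P(\mathbb R^2)$ by $[A]\cdot[v]=[Av]$, and let $\mu$ be the probability measure on $\Gamma$ with $\mu(\{a\})=\mu(\{b\})=\mu(\{c\})=\frac13$. Write $\mu^{*n}$ for the $n$-th convolution power of $\mu$ and, for a Borel probability measure $\pi$ on $X$, let $\mu^{*n}*\pi$ be the image of $\mu^{*n}\times\pi$ under $(\gamma,x)\mapsto\gamma x$. Let $\mathscr F_0=(0,1)$ and let $\mathscr F_{n+1}$ be obtained from $\mathscr F_n$ by inserting between any two successive terms $\frac{p_1}{q_1},\frac{p_2}{q_2}$ (in lowest terms) their mediant $\frac{p_1+p_2}{q_1+q_2}$. Minkowski's question mark function $\mathcal M:[0,1]\to[0,1]$ is the continuous function whose value at the $(k+1)$-th term of $\mathscr F_n$ is $k/2^n$ ($0\le k\le 2^n$). Its extension to $\mathbb R$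 is $$\bar{\mathcal M}(x)=\frac13\Big(\sum_{k=-\infty}^{n-1}\frac1{2^{|k|}}+\frac{\mathcal M(x-n)}{2^{|n|}}\Big)\qquad\text{for } x\in[n,n+1),\ n\in\mathbb Z .$$ The extended Minkowski measure $\mu_{\bar{\mathcal M}}$ is the Borel measure on $X$ that is the image, under $t\mapsto[t:1]$, of the measure on $\mathbb R$ giving mass $\bar{\mathcal M}(t)-\bar{\mathcal M}(s)$ to $[s,t)$ for $s<t$; the point $[1:0]$ has mass zero. Then for every Borel probability measure $\pi$ on $X$, the measures $\mu^{*n}*\pi$ converge to $\mu_{\bar{\mathcal M}}$ in the weak-$*$ topology as $n\to\infty$: for every continuous $f:X\to\mathbb R$, $$\lim_{n\to\infty}\int_X f\,d(\mu^{*n}*\pi)=\int_X f\,d\mu_{\bar{\mathcal M}} .$$ -/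

import Mathlib

open Set Filter Topology MeasureTheory
open scoped MatrixGroups LinearAlgebra.Projectivization ENNReal

namespace Farey

/-! ### The projective line and the action of `PSL(2, ℤ)` on it -/

/-- The projective line `P(ℝ²)`. -/
abbrev ProjLine : Type := ℙ ℝ (Fin 2 → ℝ)

/-- The quotient topology from `ℝ² ∖ {0}`. -/
instance : TopologicalSpace ProjLine :=
  inferInstanceAs (TopologicalSpace (Quotient (projectivizationSetoid ℝ (Fin 2 → ℝ))))

instance : MeasurableSpace ProjLine := borel ProjLine

instance : BorelSpace ProjLine := ⟨rfl⟩

/-- `SL(2, ℤ)` acting on the projective line through the linear action of `SL(2, ℝ)` on `ℝ²`. -/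
noncomputable def slAct : SL(2, ℤ) →* Equiv.Perm ProjLine :=
  (MulAction.toPermHom SL(2, ℝ) ProjLine).comp
    (Matrix.SpecialLinearGroup.map (Int.castRingHom ℝ))

theorem slAct_center : Subgroup.center SL(2, ℤ) ≤ slAct.ker := by
  intro A hA
  obtain ⟨r, hr, hA⟩ := Matrix.SpecialLinearGroup.mem_center_iff.mp hA
  rw [MonoidHom.mem_ker]
  ext1 x
  induction x using Projectivization.ind with
  | h v hv =>
    change (Matrix.SpecialLinearGroup.map (Int.castRingHom ℝ) A) • Projectivization.mk ℝ v hv = _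
    rw [Projectivization.smul_mk, Equiv.Perm.one_apply, Projectivization.mk_eq_mk_iff']
    refine ⟨(r : ℝ), ?_⟩
    rw [Matrix.SpecialLinearGroup.smul_def]
    have h (i j : Fin 2) : A.1 i j = if i = j then r else 0 := by
      rw [← hA, Matrix.scalar_apply, Matrix.diagonal_apply]
    ext i
    rw [Matrix.smul_eq_mulVec]
    fin_cases i <;> simp [Matrix.mulVec, dotProduct, h]

/-- The action of `PSL(2, ℤ)` on the projective line: `[A] • [v] = [A v]`. -/
noncomputable instance : MulAction PSL(2, ℤ) ProjLine :=
  MulAction.compHom ProjLine (QuotientGroup.lift _ slAct slAct_center)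

theorem mk_smul (A : SL(2, ℤ)) (x : ProjLine) :
    (QuotientGroup.mk A : PSL(2, ℤ)) • x =
      (Matrix.SpecialLinearGroup.map (Int.castRingHom ℝ) A) • x := rfl

/-! ### The Farey group and its uniform step distribution -/

/-- A matrix representing the generator `a`. -/
def matA : SL(2, ℤ) := ⟨!![1, -2; 1, -1], by simp [Matrix.det_fin_two]⟩

/-- A matrix representing the generator `b`. -/
def matB : SL(2, ℤ) := ⟨!![0, -1; 1, 0], by simp [Matrix.det_fin_two]⟩

/-- A matrix representing the generator `c`. -/
def matC : SL(2, ℤ) := ⟨!![1, -1; 2, -1], by simp [Matrix.det_fin_two]⟩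

/-- The generator `a` of the Farey group. -/
def genA : PSL(2, ℤ) := QuotientGroup.mk matA

/-- The generator `b` of the Farey group. -/
def genB : PSL(2, ℤ) := QuotientGroup.mk matB

/-- The generator `c` of the Farey group. -/
def genC : PSL(2, ℤ) := QuotientGroup.mk matC

/-- The Farey group, the subgroup of `PSL(2, ℤ)` generated by `a`, `b`, `c`. -/
def fareyGroup : Subgroup PSL(2, ℤ) := Subgroup.closure {genA, genB, genC}

/-- The Farey group is a countable discrete group: every subset is measurable. -/
instance : MeasurableSpace fareyGroup := ⊤

/-- The generator `a` as an element of the Farey group. -/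
def a : fareyGroup := ⟨genA, Subgroup.subset_closure (by simp)⟩

/-- The generator `b` as an element of the Farey group. -/
def b : fareyGroup := ⟨genB, Subgroup.subset_closure (by simp)⟩

/-- The generator `c` as an element of the Farey group. -/
def c : fareyGroup := ⟨genC, Subgroup.subset_closure (by simp)⟩

/-- The measure `μ` on the Farey group with `μ {a} = μ {b} = μ {c} = 1/3`. -/
noncomputable def stepMeasure : Measure fareyGroup :=
  (3⁻¹ : ℝ≥0∞) • (Measure.dirac a + Measure.dirac b + Measure.dirac c)

/-- The convolution power `μ^{*n}` (the Dirac mass at the identity for `n = 0`). -/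
noncomputable def convPow (μ : Measure fareyGroup) : ℕ → Measure fareyGroup
  | 0 => Measure.dirac 1
  | n + 1 => Measure.mconv μ (convPow μ n)

/-- The convolution `μ * π` of a measure on the group with a measure on the projective line:
the law of `γ x` for independent `γ` and `x` of laws `μ` and `π`. -/
noncomputable def actConv (μ : Measure fareyGroup) (π : Measure ProjLine) : Measure ProjLine :=
  (μ.prod π).map (fun p : fareyGroup × ProjLine => p.1 • p.2)

/-! ### Farey sequences and the Minkowski question mark function -/

/-- The mediant `p₁/q₁ ⊕ p₂/q₂ = (p₁ + p₂)/(q₁ + q₂)` of fractions in lowest terms. -/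
def mediant (p q : ℚ) : ℚ := ((p.num + q.num : ℤ) : ℚ) / ((p.den + q.den : ℕ) : ℚ)

/-- `fareyTerm n k`, for `0 ≤ k ≤ 2 ^ n`, is the `(k+1)`-th term of the `n`-th Farey sequence:
the sequence of level `0` is `(0, 1)`, and that of level `n + 1` is obtained from that of level
`n` by inserting the mediant between any two successive terms. (Values at `k > 2 ^ n` are not
used.) -/
def fareyTerm : ℕ → ℕ → ℚ
  | 0, k => k
  | n + 1, k =>
    if k % 2 = 0 then fareyTerm n (k / 2)
    else mediant (fareyTerm n (k / 2)) (fareyTerm n (k / 2 + 1))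

/-- The Minkowski question mark function on `[0, 1]`: it takes the value `k / 2 ^ n` at the
`(k+1)`-th term of the `n`-th Farey sequence, and is extended from the rationals to the reals
monotonically, hence continuously (the values on the rationals being dense in `[0, 1]`). -/
noncomputable def minkowski (x : ℝ) : ℝ :=
  sSup {y : ℝ | ∃ n k : ℕ, k ≤ 2 ^ n ∧ (fareyTerm n k : ℝ) ≤ x ∧ y = (k : ℝ) / 2 ^ n}

theorem lt_mediant {p q : ℚ} (h : p < q) : p < mediant p q ∧ mediant p q < q := by
  have hp : (0 : ℚ) < p.den := by exact_mod_cast p.den_pos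
  have hq : (0 : ℚ) < q.den := by exact_mod_cast q.den_pos
  have e1 : (p.num : ℚ) = p * p.den := (Rat.mul_den_eq_num p).symm
  have e2 : (q.num : ℚ) = q * q.den := (Rat.mul_den_eq_num q).symm
  unfold mediant
  push_cast
  constructor
  · rw [lt_div_iff₀ (by positivity), e1, e2]
    nlinarith
  · rw [div_lt_iff₀ (by positivity), e1, e2]
    nlinarith

theorem fareyTerm_lt_succ (n : ℕ) : ∀ k < 2 ^ n, fareyTerm n k < fareyTerm n (k + 1) := by
  induction n with
  | zero => intro k _; simp [fareyTerm]
  | succ n ih =>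
    intro k hk
    have h2 : k / 2 < 2 ^ n := by rw [pow_succ] at hk; omega
    have := lt_mediant (ih _ h2)
    rcases Nat.mod_two_eq_zero_or_one k with h | h
    · have h3 : (k + 1) / 2 = k / 2 := by omega
      have h4 : (k + 1) % 2 = 1 := by omega
      simpa [fareyTerm, h, h3, h4] using this.1
    · have h3 : (k + 1) / 2 = k / 2 + 1 := by omega
      have h4 : (k + 1) % 2 = 0 := by omega
      simpa [fareyTerm, h, h3, h4] using this.2

theorem fareyTerm_strictMono (n : ℕ) : ∀ {j k : ℕ}, j < k → k ≤ 2 ^ n →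
    fareyTerm n j < fareyTerm n k := by
  intro j k hjk
  induction k, hjk using Nat.le_induction with
  | base => intro hk; exact fareyTerm_lt_succ n j hk
  | succ k _ ih => intro hk; exact (ih (by omega)).trans (fareyTerm_lt_succ n k hk)

theorem fareyTerm_add (n m k : ℕ) : fareyTerm (n + m) (k * 2 ^ m) = fareyTerm n k := by
  induction m with
  | zero => simp
  | succ m ih =>
    have h1 : k * 2 ^ (m + 1) % 2 = 0 := by rw [pow_succ, ← mul_assoc]; omega
    have h2 : k * 2 ^ (m + 1) / 2 = k * 2 ^ m := by rw [pow_succ, ← mul_assoc]; omega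
    rw [← add_assoc, fareyTerm, if_pos h1, h2, ih]

theorem minkowski_set_le {n k : ℕ} (hk : k ≤ 2 ^ n) : (k : ℝ) / 2 ^ n ≤ 1 := by
  rw [div_le_one (by positivity)]
  exact_mod_cast hk

theorem minkowski_bddAbove (x : ℝ) : BddAbove
    {y : ℝ | ∃ n k : ℕ, k ≤ 2 ^ n ∧ (fareyTerm n k : ℝ) ≤ x ∧ y = (k : ℝ) / 2 ^ n} := by
  refine ⟨1, ?_⟩
  rintro _ ⟨n, k, hk, -, rfl⟩
  exact minkowski_set_le hk

theorem minkowski_nonneg (x : ℝ) : 0 ≤ minkowski x := by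
  apply Real.sSup_nonneg
  rintro _ ⟨n, k, -, -, rfl⟩
  positivity

theorem minkowski_le_one (x : ℝ) : minkowski x ≤ 1 := by
  apply Real.sSup_le _ zero_le_one
  rintro _ ⟨n, k, hk, -, rfl⟩
  exact minkowski_set_le hk

theorem minkowski_mono : Monotone minkowski := by
  intro x y hxy
  apply Real.sSup_le _ (minkowski_nonneg y)
  rintro _ ⟨n, k, hk, hx, rfl⟩
  exact le_csSup (minkowski_bddAbove y) ⟨n, k, hk, hx.trans hxy, rfl⟩

theorem minkowski_fareyTerm {n k : ℕ} (hk : k ≤ 2 ^ n) :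
    minkowski (fareyTerm n k) = (k : ℝ) / 2 ^ n := by
  apply le_antisymm
  · apply Real.sSup_le _ (by positivity)
    rintro _ ⟨m, j, hj, hle, rfl⟩
    rw [Rat.cast_le, ← fareyTerm_add m n j, ← fareyTerm_add n m k, add_comm n m] at hle
    have h1 : k * 2 ^ m ≤ 2 ^ (m + n) := by rw [pow_add, mul_comm]; gcongr
    have h2 : j * 2 ^ n ≤ 2 ^ (m + n) := by rw [pow_add]; gcongr
    have h3 : j * 2 ^ n ≤ k * 2 ^ m := by
      by_contra! hlt
      exact absurd (fareyTerm_strictMono (m + n) hlt h2) (not_lt.mpr hle)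
    rw [div_le_div_iff₀ (by positivity) (by positivity)]
    exact_mod_cast h3
  · exact le_csSup (minkowski_bddAbove _) ⟨n, k, hk, le_rfl, rfl⟩

theorem minkowski_continuous : Continuous minkowski := by
  have hm : ∀ x, minkowski x ∈ Icc (0 : ℝ) 1 := fun x => ⟨minkowski_nonneg x, minkowski_le_one x⟩
  have hmono : Monotone (fun x => (⟨minkowski x, hm x⟩ : Icc (0 : ℝ) 1)) :=
    fun x y h => minkowski_mono h
  have hdense : DenseRange (fun x => (⟨minkowski x, hm x⟩ : Icc (0 : ℝ) 1)) := by
    rw [DenseRange, Metric.dense_iff]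
    rintro ⟨y, hy0, hy1⟩ r hr
    obtain ⟨n, hn⟩ := exists_pow_lt_of_lt_one hr (show (1 / 2 : ℝ) < 1 by norm_num)
    have hk1 : ⌊y * 2 ^ n⌋₊ ≤ 2 ^ n := by
      apply Nat.floor_le_of_le
      push_cast
      exact mul_le_of_le_one_left (by positivity) hy1
    have hp : (0 : ℝ) < 2 ^ n := by positivity
    have ha := Nat.floor_le (show 0 ≤ y * 2 ^ n by positivity)
    have hb := Nat.lt_floor_add_one (y * 2 ^ n)
    refine ⟨_, ?_, ⟨(fareyTerm n ⌊y * 2 ^ n⌋₊ : ℝ), rfl⟩⟩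
    rw [Metric.mem_ball, Subtype.dist_eq, Real.dist_eq]
    simp only [minkowski_fareyTerm hk1]
    rw [one_div, inv_pow] at hn
    have h1 : (⌊y * 2 ^ n⌋₊ : ℝ) / 2 ^ n ≤ y := by rwa [div_le_iff₀ hp]
    have h2 : y < (⌊y * 2 ^ n⌋₊ : ℝ) / 2 ^ n + (2 ^ n)⁻¹ := by
      rw [← one_div, ← add_div, lt_div_iff₀ hp]
      exact hb
    rw [abs_lt]
    constructor <;> linarith
  exact continuous_subtype_val.comp (hmono.continuous_of_denseRange hdense)

/-! ### The extended Minkowski function and measure -/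

/-- The extension of the Minkowski function to the real line: for `x ∈ [n, n + 1)`, `n ∈ ℤ`, it is
`(∑_{k ≤ n - 1} 2 ^ (-|k|) + M(x - n) / 2 ^ |n|) / 3`. -/
noncomputable def extMinkowskiFun (x : ℝ) : ℝ :=
  (1 / 3) * ((∑' k : Iio ⌊x⌋, 1 / (2 : ℝ) ^ (k : ℤ).natAbs) +
    minkowski (Int.fract x) / (2 : ℝ) ^ ⌊x⌋.natAbs)

theorem summable_half_natAbs : Summable (fun k : ℤ => 1 / (2 : ℝ) ^ k.natAbs) := by
  have h : Summable (fun n : ℕ => 1 / (2 : ℝ) ^ n) := by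
    simpa [one_div, inv_pow] using summable_geometric_two
  apply Summable.of_nat_of_neg <;> simpa using h

theorem extMinkowski_jump {m n : ℤ} (h : m < n) :
    (∑' k : Iio m, 1 / (2 : ℝ) ^ (k : ℤ).natAbs) + 1 / (2 : ℝ) ^ m.natAbs ≤
      ∑' k : Iio n, 1 / (2 : ℝ) ^ (k : ℤ).natAbs := by
  have hs := summable_half_natAbs
  rw [← tsum_singleton m (fun k : ℤ => 1 / (2 : ℝ) ^ k.natAbs),
    ← (hs.subtype _).tsum_union_disjoint (by simp) (hs.subtype _)]
  have hsub : Iio m ∪ {m} ⊆ Iio n := by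
    rintro k (hk | hk)
    · exact lt_trans hk h
    · rw [mem_singleton_iff.mp hk]; exact h
  rw [tsum_subtype (Iio m ∪ {m}) (fun k : ℤ => 1 / (2 : ℝ) ^ k.natAbs),
    tsum_subtype (Iio n) (fun k : ℤ => 1 / (2 : ℝ) ^ k.natAbs)]
  exact Summable.tsum_le_tsum (indicator_le_indicator_of_subset hsub fun _ => by positivity)
    (hs.indicator _) (hs.indicator _)

theorem extMinkowskiFun_mono : Monotone extMinkowskiFun := by
  intro x y hxy
  unfold extMinkowskiFun
  gcongr 1 / 3 * ?_
  rcases (Int.floor_mono hxy).eq_or_lt with h | h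
  · have : Int.fract x ≤ Int.fract y := by
      unfold Int.fract; rw [h]; linarith
    rw [h]
    gcongr
    exact minkowski_mono this
  · have h1 := extMinkowski_jump h
    have h2 : minkowski (Int.fract x) / (2 : ℝ) ^ ⌊x⌋.natAbs ≤ 1 / (2 : ℝ) ^ ⌊x⌋.natAbs := by
      gcongr; exact minkowski_le_one _
    have h3 : 0 ≤ minkowski (Int.fract y) / (2 : ℝ) ^ ⌊y⌋.natAbs :=
      div_nonneg (minkowski_nonneg _) (by positivity)
    linarith

theorem extMinkowskiFun_right_continuous (x : ℝ) :
    ContinuousWithinAt extMinkowskiFun (Ici x) x := by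
  have hc : ContinuousWithinAt (fun y : ℝ => (1 / 3) *
      ((∑' k : Iio ⌊x⌋, 1 / (2 : ℝ) ^ (k : ℤ).natAbs) +
        minkowski (y - ⌊x⌋) / (2 : ℝ) ^ ⌊x⌋.natAbs)) (Ici x) x := by
    have := minkowski_continuous
    exact Continuous.continuousWithinAt (by fun_prop)
  refine hc.congr_of_eventuallyEq ?_ rfl
  filter_upwards [Ico_mem_nhdsGE (Int.lt_floor_add_one x)] with y hy
  have : ⌊y⌋ = ⌊x⌋ := Int.floor_eq_iff.mpr ⟨(Int.floor_le x).trans hy.1, hy.2⟩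
  unfold extMinkowskiFun Int.fract
  rw [this]

/-- The extended Minkowski function as a distribution function. -/
noncomputable def extMinkowski : StieltjesFunction ℝ where
  toFun := extMinkowskiFun
  mono' := extMinkowskiFun_mono
  right_continuous' := extMinkowskiFun_right_continuous

/-- The affine chart `t ↦ [t : 1]`, which identifies `ℝ` with the complement of the point
`∞ = [1 : 0]` of the projective line. -/
noncomputable def affineChart (t : ℝ) : ProjLine := Projectivization.mk ℝ ![t, 1] (by simp)

/-- The extended Minkowski measure on the projective line: the Lebesgue-Stieltjes measure of the
extended Minkowski function on `ℝ` (an interval with endpoints `s < t` has mass the increment of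
that continuous function), carried to the projective line by `t ↦ [t : 1]` (the point
`∞` has mass zero). -/
noncomputable def extMinkowskiMeasure : Measure ProjLine :=
  extMinkowski.measure.map affineChart

end Farey

/-!
The walk `γ₁ γ₂ ⋯ γₙ x` forgets its starting point `x`, and the extended Minkowski measure is
stationary; together these give the convergence.

*Contraction.* Let `Q = x² - x y + y²` and let `d(v, w) = (det(v, w)² / (Q v Q w)) ^ (1/6)`, a power
of a projective distance. A generator `g` preserves determinants, so it multiplies `d(v, w)` by
`(u u') ^ (-1/6)`, where `u = Q (g v) / Q v` and `u' = Q (g w) / Q w`, and this is at most the mean of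
`u ^ (-1/3)` and `u' ^ (-1/3)`. The three ratios `u` at a given `v` have sum `5` and sum of squares
`11`, and are at least `1/3`. A quadratic majorant of `u ^ (-1/3)` on `[1/3, ∞)` therefore bounds
the sum of the three powers by a constant less than `3` (`sum_rpow_quadForm_le`). Hence the average
of `d` over the generators contracts by a uniform factor (`sum_projDist_le`). A continuous function
is Lipschitz for `d` up to an arbitrarily small error (`exists_abs_sub_le`), so the oscillation of
its iterated averages `P^n f`, `P f = (f ∘ a + f ∘ b + f ∘ c) / 3`, tends to `0`
(`abs_average_iterate_sub_le`).

*Stationarity.* Each generator is an involution exchanging one of the arcs `(1, ∞)`, `(∞, 0)`,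
`(0, 1)` with its complement. It maps the complement to the arc with all masses halved, hence the
arc to the complement with all masses doubled. Every point other than `0`, `1`, `∞` lies in exactly
one arc, and `(2 + 1/2 + 1/2) / 3 = 1`. In terms of the distribution function `F` the halving comes down to
`F(t + 1) = (1 + F t) / 2` for `t ≥ 0`, `F(1 - t) = 1 - F t` and `F(1 / t) = 4 / 3 - F t` for `t > 0`,
which follow from the equations `M(1 - x) = 1 - M x` and `M(x / (1 + x)) = M x / 2` of the question
mark function; these express that `x ↦ 1 - x` and `x ↦ x / (1 + x)` respect mediants.

Since `∫ f d(μ^{*n} * π) = ∫ P^n f dπ` and `∫ P^n f dν = ∫ f dν` for the stationary measure `ν`,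
both integrals are within the oscillation of `P^n f` of any one of its values.
-/

namespace Farey

/-! ### Functional equations of the question mark function -/

theorem fareyTerm_zero (n : ℕ) : fareyTerm n 0 = 0 := by
  induction n with
  | zero => simp [fareyTerm]
  | succ n ih => simpa [fareyTerm] using ih

theorem fareyTerm_two_pow (n : ℕ) : fareyTerm n (2 ^ n) = 1 := by
  simpa [fareyTerm] using fareyTerm_add 0 n 1

theorem fareyTerm_nonneg {n k : ℕ} (hk : k ≤ 2 ^ n) : 0 ≤ fareyTerm n k := by
  rcases Nat.eq_zero_or_pos k with rfl | h
  · exact (fareyTerm_zero n).ge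
  · exact (fareyTerm_zero n).symm.le.trans (fareyTerm_strictMono n h hk).le

theorem fareyTerm_le_one {n k : ℕ} (hk : k ≤ 2 ^ n) : fareyTerm n k ≤ 1 := by
  rcases hk.eq_or_lt with rfl | h
  · exact (fareyTerm_two_pow n).le
  · exact (fareyTerm_strictMono n h le_rfl).le.trans (fareyTerm_two_pow n).le

/-- The map `p ↦ 1 - p` sends the reduced fraction `m / n` to the reduced fraction `(n - m) / n`,
so it commutes with mediants. -/
theorem mediant_one_sub (p q : ℚ) : mediant (1 - q) (1 - p) = 1 - mediant p q := by
  have hn (p : ℚ) : (1 - p).num = p.den - p.num ∧ (1 - p).den = p.den := by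
    have e : (1 : ℚ) - p = (((p.den : ℤ) - p.num : ℤ) : ℚ) / ((p.den : ℤ) : ℚ) := by
      have hp : (p.den : ℚ) ≠ 0 := by exact_mod_cast p.den_nz
      push_cast
      rw [sub_div, div_self hp, Rat.num_div_den]
    have hc : Nat.Coprime ((p.den : ℤ) - p.num).natAbs (p.den : ℤ).natAbs := by
      have := p.isCoprime_num_den
      change Int.gcd _ _ = 1
      rw [← Int.isCoprime_iff_gcd_eq_one]
      rw [show (p.den : ℤ) - p.num = -p.num + p.den * 1 by ring]
      exact this.neg_left.add_mul_left_left 1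
    have hpos : (0 : ℤ) < p.den := by exact_mod_cast p.den_pos
    constructor
    · rw [e, Rat.num_div_eq_of_coprime hpos hc]
    · have := Rat.den_div_eq_of_coprime hpos hc
      rw [← e] at this
      exact_mod_cast this
  have hp : (p.den : ℚ) ≠ 0 := by exact_mod_cast p.den_nz
  have hq : (0 : ℚ) < (p.den : ℚ) + q.den := by
    have := p.den_pos
    have := q.den_pos
    positivity
  unfold mediant
  rw [(hn p).1, (hn p).2, (hn q).1, (hn q).2]
  push_cast
  field_simp
  ring

/-- The map `p ↦ p / (1 + p)` sends the reduced fraction `m / n` to the reduced fraction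
`m / (m + n)`, so it commutes with mediants. -/
theorem mediant_div_one_add {p q : ℚ} (hp : 0 ≤ p) (hq : 0 ≤ q) :
    mediant (p / (1 + p)) (q / (1 + q)) = mediant p q / (1 + mediant p q) := by
  have hn {p : ℚ} (hp : 0 ≤ p) :
      (p / (1 + p)).num = p.num ∧ ((p / (1 + p)).den : ℤ) = p.num + p.den := by
    have hpos : (0 : ℤ) < p.den := by exact_mod_cast p.den_pos
    have hnum : 0 ≤ p.num := Rat.num_nonneg.mpr hp
    have e : p / (1 + p) = (p.num : ℚ) / ((p.num + p.den : ℤ) : ℚ) := by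
      have h0 : (p.den : ℚ) ≠ 0 := by exact_mod_cast p.den_nz
      have h1 : (p.num : ℚ) = p * p.den := (Rat.mul_den_eq_num p).symm
      push_cast
      rw [h1]
      have : 1 + p ≠ 0 := by positivity
      rw [show p * p.den + p.den = (1 + p) * (p.den : ℚ) by ring]
      field_simp
    have hc : Nat.Coprime p.num.natAbs (p.num + p.den : ℤ).natAbs := by
      have := p.isCoprime_num_den
      change Int.gcd _ _ = 1
      rw [← Int.isCoprime_iff_gcd_eq_one]
      rw [show p.num + (p.den : ℤ) = p.den + p.num * 1 by ring]
      exact this.add_mul_left_right 1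
    rw [e]
    exact ⟨Rat.num_div_eq_of_coprime (by omega) hc, Rat.den_div_eq_of_coprime (by omega) hc⟩
  obtain ⟨h1, h2⟩ := hn hp
  obtain ⟨h3, h4⟩ := hn hq
  have h2' : ((p / (1 + p)).den : ℚ) = p.num + p.den := by exact_mod_cast h2
  have h4' : ((q / (1 + q)).den : ℚ) = q.num + q.den := by exact_mod_cast h4
  have hp0 : (0 : ℚ) ≤ p.num := by exact_mod_cast Rat.num_nonneg.mpr hp
  have hq0 : (0 : ℚ) ≤ q.num := by exact_mod_cast Rat.num_nonneg.mpr hq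
  have hp1 : (0 : ℚ) < p.den := by exact_mod_cast p.den_pos
  have hq1 : (0 : ℚ) < q.den := by exact_mod_cast q.den_pos
  unfold mediant
  push_cast
  rw [h1, h2', h3, h4']
  field_simp
  ring

theorem fareyTerm_two_pow_sub (n : ℕ) :
    ∀ k ≤ 2 ^ n, fareyTerm n (2 ^ n - k) = 1 - fareyTerm n k := by
  induction n with
  | zero => intro k hk; interval_cases k <;> simp [fareyTerm]
  | succ n ih =>
    intro k hk
    rw [pow_succ] at hk ⊢
    rcases Nat.mod_two_eq_zero_or_one k with h | h
    · have h1 : (2 ^ n * 2 - k) % 2 = 0 := by omega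
      have h2 : (2 ^ n * 2 - k) / 2 = 2 ^ n - k / 2 := by omega
      simp only [fareyTerm, h, h1, h2, if_true]
      exact ih _ (by omega)
    · have h1 : (2 ^ n * 2 - k) % 2 = 1 := by omega
      have h2 : (2 ^ n * 2 - k) / 2 = 2 ^ n - (k / 2 + 1) := by omega
      have h3 : 2 ^ n - (k / 2 + 1) + 1 = 2 ^ n - k / 2 := by omega
      simp only [fareyTerm, h, h1, h2, h3, one_ne_zero, if_false]
      rw [ih _ (by omega), ih _ (by omega), mediant_one_sub]

/-- The left half of each Farey sequence is the image of the previous sequence under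
`x ↦ x / (1 + x)`. -/
theorem fareyTerm_succ_left (n : ℕ) :
    ∀ k ≤ 2 ^ n, fareyTerm (n + 1) k = fareyTerm n k / (1 + fareyTerm n k) := by
  induction n with
  | zero => intro k hk; interval_cases k <;> norm_num [fareyTerm, mediant]
  | succ n ih =>
    intro k hk
    rw [pow_succ] at hk
    rw [fareyTerm]
    rcases Nat.mod_two_eq_zero_or_one k with h | h
    · rw [if_pos h, ih _ (by omega)]
      simp only [fareyTerm, h, if_true]
    · rw [if_neg (by omega), ih _ (by omega), ih _ (by omega),
        mediant_div_one_add (fareyTerm_nonneg (by omega)) (fareyTerm_nonneg (by omega))]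
      simp only [fareyTerm, h, one_ne_zero, if_false]

/-- A monotone function on `[0, 1]` with the values of the question mark function at the Farey
fractions is that function, since the values are dense in `[0, 1]`. -/
theorem eq_minkowski_of_monotoneOn {φ : ℝ → ℝ} (hφ : MonotoneOn φ (Icc 0 1))
    (h : ∀ n k : ℕ, k ≤ 2 ^ n → φ (fareyTerm n k) = (k : ℝ) / 2 ^ n) {x : ℝ}
    (hx : x ∈ Icc (0 : ℝ) 1) : φ x = minkowski x := by
  have hmem {n k : ℕ} (hk : k ≤ 2 ^ n) : (fareyTerm n k : ℝ) ∈ Icc (0 : ℝ) 1 :=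
    ⟨by exact_mod_cast fareyTerm_nonneg hk, by exact_mod_cast fareyTerm_le_one hk⟩
  have h0 : 0 ≤ φ x := by
    have := hφ (hmem (n := 0) (k := 0) (by simp)) hx (by simpa [fareyTerm] using hx.1)
    rw [h 0 0 (by simp)] at this
    simpa using this
  have h1 : φ x ≤ 1 := by
    have := hφ hx (hmem (n := 0) (k := 1) (by simp)) (by simpa [fareyTerm] using hx.2)
    rw [h 0 1 (by simp)] at this
    simpa using this
  have hdy {u v : ℝ} (hu : 0 ≤ u) (hv : v ≤ 1) (huv : u < v) :
      ∃ n k : ℕ, k ≤ 2 ^ n ∧ u < (k : ℝ) / 2 ^ n ∧ (k : ℝ) / 2 ^ n < v := by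
    obtain ⟨n, hn⟩ := exists_pow_lt_of_lt_one (sub_pos.mpr huv) (show (1 / 2 : ℝ) < 1 by norm_num)
    have hp : (0 : ℝ) < 2 ^ n := by positivity
    have ha := Nat.floor_le (show 0 ≤ u * 2 ^ n by positivity)
    have hb := Nat.lt_floor_add_one (u * 2 ^ n)
    have hn' : 1 < (v - u) * 2 ^ n := by
      rw [one_div, inv_pow] at hn
      rwa [← inv_lt_iff_one_lt_mul₀ hp]
    have hlt : ((⌊u * 2 ^ n⌋₊ + 1 : ℕ) : ℝ) < v * 2 ^ n := by push_cast; nlinarith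
    refine ⟨n, ⌊u * 2 ^ n⌋₊ + 1, ?_, ?_, ?_⟩
    · have : ((⌊u * 2 ^ n⌋₊ + 1 : ℕ) : ℝ) < 2 ^ n :=
        hlt.trans_le (mul_le_of_le_one_left hp.le hv)
      exact_mod_cast this.le
    · rw [lt_div_iff₀ hp]; exact_mod_cast hb
    · rwa [div_lt_iff₀ hp]
  apply le_antisymm
  · by_contra! hlt
    obtain ⟨n, k, hk, hl, hr⟩ := hdy (minkowski_nonneg x) h1 hlt
    rw [← h n k hk] at hr
    rw [← minkowski_fareyTerm hk] at hl
    rcases le_total x (fareyTerm n k) with hle | hle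
    · exact (hφ hx (hmem hk) hle).not_gt hr
    · exact (minkowski_mono hle).not_gt hl
  · by_contra! hlt
    obtain ⟨n, k, hk, hl, hr⟩ := hdy h0 (minkowski_le_one x) hlt
    rw [← h n k hk] at hl
    rw [← minkowski_fareyTerm hk] at hr
    rcases le_total x (fareyTerm n k) with hle | hle
    · exact (minkowski_mono hle).not_gt hr
    · exact (hφ (hmem hk) hx hle).not_gt hl

theorem minkowski_one_sub {x : ℝ} (hx : x ∈ Icc (0 : ℝ) 1) :
    minkowski (1 - x) = 1 - minkowski x := by
  have := eq_minkowski_of_monotoneOn (φ := fun x => 1 - minkowski (1 - x)) ?_ ?_ hx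
  · linarith
  · intro u _ v _ huv
    have := minkowski_mono (sub_le_sub_left huv 1)
    linarith
  · intro n k hk
    have e : (1 : ℝ) - fareyTerm n k = fareyTerm n (2 ^ n - k) := by
      rw [fareyTerm_two_pow_sub n k hk]; push_cast; ring
    rw [e, minkowski_fareyTerm (Nat.sub_le _ _), Nat.cast_sub hk]
    push_cast
    field_simp
    ring

theorem minkowski_div_one_add {x : ℝ} (hx : x ∈ Icc (0 : ℝ) 1) :
    minkowski (x / (1 + x)) = minkowski x / 2 := by
  have := eq_minkowski_of_monotoneOn (φ := fun x => 2 * minkowski (x / (1 + x))) ?_ ?_ hx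
  · linarith
  · intro u hu v hv huv
    have hu0 := hu.1
    have hv0 := hv.1
    have : u / (1 + u) ≤ v / (1 + v) := by
      rw [div_le_div_iff₀ (by linarith) (by linarith)]
      linarith
    have := minkowski_mono this
    linarith
  · intro n k hk
    have e : (fareyTerm n k : ℝ) / (1 + fareyTerm n k) = fareyTerm (n + 1) k := by
      rw [fareyTerm_succ_left n k hk]; push_cast; ring
    rw [e, minkowski_fareyTerm (hk.trans (Nat.pow_le_pow_right (by norm_num) n.le_succ)), pow_succ]
    field_simp

theorem minkowski_inv_one_add {x : ℝ} (hx : x ∈ Icc (0 : ℝ) 1) :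
    minkowski (1 / (1 + x)) = 1 - minkowski x / 2 := by
  have h0 := hx.1
  have hpos : 0 < 1 + x := by linarith
  rw [← minkowski_div_one_add hx, ← minkowski_one_sub]
  · congr 1
    field_simp
    ring
  · exact ⟨by positivity, by rw [div_le_one hpos]; linarith⟩

theorem minkowski_zero : minkowski 0 = 0 := by
  simpa [fareyTerm] using minkowski_fareyTerm (n := 0) (k := 0) (by simp)

theorem minkowski_one : minkowski 1 = 1 := by
  simpa [fareyTerm] using minkowski_fareyTerm (n := 0) (k := 1) (by simp)

/-! ### Functional equations of the extended Minkowski function -/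

theorem tsum_Iio_succ (n : ℤ) :
    (∑' k : Iio (n + 1), 1 / (2 : ℝ) ^ (k : ℤ).natAbs) =
      (∑' k : Iio n, 1 / (2 : ℝ) ^ (k : ℤ).natAbs) + 1 / 2 ^ n.natAbs := by
  have hs := summable_half_natAbs
  have e : Iio (n + 1) = Iio n ∪ {n} := by
    ext k
    simp only [mem_Iio, mem_union, mem_singleton_iff]
    omega
  rw [← tsum_singleton n (fun k : ℤ => 1 / (2 : ℝ) ^ k.natAbs), e,
    (hs.subtype _).tsum_union_disjoint (by simp) (hs.subtype _)]

theorem tsum_Iio_neg (n : ℕ) :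
    (∑' k : Iio (-(n : ℤ)), 1 / (2 : ℝ) ^ (k : ℤ).natAbs) = (1 / 2) ^ n := by
  let e : ℕ ≃ Iio (-(n : ℤ)) :=
    { toFun := fun j => ⟨-(n : ℤ) - 1 - j, by simp only [mem_Iio]; omega⟩
      invFun := fun k => (-(n : ℤ) - 1 - k).toNat
      left_inv := fun j => by simp
      right_inv := fun ⟨k, hk⟩ => by
        rw [mem_Iio] at hk
        ext
        simp only
        omega }
  rw [← e.tsum_eq]
  have h (j : ℕ) : 1 / (2 : ℝ) ^ ((e j : ℤ)).natAbs = (1 / 2) ^ (n + 1) * (1 / 2) ^ j := by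
    have : (e j : ℤ).natAbs = n + 1 + j := by
      simp only [e, Equiv.coe_fn_mk]
      omega
    rw [this, ← pow_add, one_div_pow]
  simp_rw [h]
  rw [tsum_mul_left, tsum_geometric_two, pow_succ]
  ring

theorem tsum_Iio_nat (n : ℕ) :
    (∑' k : Iio (n : ℤ), 1 / (2 : ℝ) ^ (k : ℤ).natAbs) = 3 - 2 * (1 / 2) ^ n := by
  induction n with
  | zero => simpa using (tsum_Iio_neg 0).trans (by norm_num)
  | succ n ih =>
    push_cast
    rw [tsum_Iio_succ, ih, Int.natAbs_natCast, pow_succ, one_div_pow]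
    ring

theorem extMinkowskiFun_nat_add (n : ℕ) {x : ℝ} (hx : x ∈ Ico (0 : ℝ) 1) :
    extMinkowskiFun (n + x) = 1 - (1 / 2) ^ n * (2 - minkowski x) / 3 := by
  have h : ⌊(n : ℝ) + x⌋ = (n : ℤ) := by
    rw [Int.floor_eq_iff]
    push_cast
    constructor <;> linarith [hx.1, hx.2]
  rw [extMinkowskiFun, Int.fract, h, tsum_Iio_nat, Int.natAbs_natCast, one_div_pow, Int.cast_natCast,
    add_sub_cancel_left]
  ring

theorem extMinkowskiFun_neg_add (n : ℕ) {x : ℝ} (hx : x ∈ Ico (0 : ℝ) 1) :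
    extMinkowskiFun (-n + x) = (1 / 2) ^ n * (1 + minkowski x) / 3 := by
  have h : ⌊-(n : ℝ) + x⌋ = -(n : ℤ) := by
    rw [Int.floor_eq_iff]
    push_cast
    constructor <;> linarith [hx.1, hx.2]
  rw [extMinkowskiFun, Int.fract, h, tsum_Iio_neg, Int.natAbs_neg, Int.natAbs_natCast, one_div_pow]
  push_cast
  rw [sub_neg_eq_add, neg_add_cancel_comm]
  ring

theorem exists_nat_add_fract {t : ℝ} (ht : 0 ≤ t) : ∃ n : ℕ, ∃ x ∈ Ico (0 : ℝ) 1, t = n + x :=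
  ⟨⌊t⌋₊, t - ⌊t⌋₊, ⟨sub_nonneg.mpr (Nat.floor_le ht), by linarith [Nat.lt_floor_add_one t]⟩,
    by ring⟩

theorem extMinkowskiFun_of_mem_Icc {t : ℝ} (ht : t ∈ Icc (0 : ℝ) 1) :
    extMinkowskiFun t = (1 + minkowski t) / 3 := by
  rcases ht.2.eq_or_lt with rfl | h
  · have := extMinkowskiFun_nat_add 1 (x := 0) (by simp)
    rw [minkowski_zero] at this
    rw [minkowski_one]
    norm_num at this ⊢
    exact this
  · have := extMinkowskiFun_nat_add 0 ⟨ht.1, h⟩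
    norm_num at this
    rw [this]
    ring

theorem extMinkowskiFun_add_one {t : ℝ} (ht : 0 ≤ t) :
    extMinkowskiFun (t + 1) = (1 + extMinkowskiFun t) / 2 := by
  obtain ⟨n, x, hx, rfl⟩ := exists_nat_add_fract ht
  have := extMinkowskiFun_nat_add (n + 1) hx
  rw [extMinkowskiFun_nat_add n hx, show (n : ℝ) + x + 1 = (n + 1 : ℕ) + x by push_cast; ring,
    this, pow_succ]
  ring

theorem extMinkowskiFun_sub_one {t : ℝ} (ht : t ≤ 1) :
    extMinkowskiFun (t - 1) = extMinkowskiFun t / 2 := by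
  rcases ht.eq_or_lt with rfl | h
  · rw [sub_self, extMinkowskiFun_of_mem_Icc (by simp), extMinkowskiFun_of_mem_Icc (by simp),
      minkowski_zero, minkowski_one]
    norm_num
  obtain ⟨n, x, hx, e⟩ : ∃ n : ℕ, ∃ x ∈ Ico (0 : ℝ) 1, t = -n + x := by
    have h1 : ⌊t⌋ ≤ 0 := Int.floor_le_iff.mpr (by simpa using h)
    refine ⟨(-⌊t⌋).toNat, Int.fract t, ⟨Int.fract_nonneg t, Int.fract_lt_one t⟩, ?_⟩
    have h2 : (((-⌊t⌋).toNat : ℤ) : ℝ) = ((-⌊t⌋ : ℤ) : ℝ) := by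
      rw [Int.toNat_of_nonneg (by omega)]
    push_cast at h2
    rw [h2, neg_neg, Int.floor_add_fract]
  have := extMinkowskiFun_neg_add (n + 1) hx
  rw [e, extMinkowskiFun_neg_add n hx, show -(n : ℝ) + x - 1 = -(n + 1 : ℕ) + x by push_cast; ring,
    this, pow_succ]
  ring

theorem extMinkowskiFun_one_sub_of_nonneg {t : ℝ} (ht : 0 ≤ t) :
    extMinkowskiFun (1 - t) = 1 - extMinkowskiFun t := by
  obtain ⟨n, x, hx, rfl⟩ := exists_nat_add_fract ht
  induction n with
  | zero =>
    have hx' : x ∈ Icc (0 : ℝ) 1 := ⟨hx.1, hx.2.le⟩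
    simp only [Nat.cast_zero, zero_add]
    rw [extMinkowskiFun_of_mem_Icc hx', extMinkowskiFun_of_mem_Icc
      ⟨sub_nonneg.mpr hx'.2, by linarith [hx.1]⟩, minkowski_one_sub hx']
    ring
  | succ n ih =>
    have h0 : 0 ≤ (n : ℝ) + x := add_nonneg n.cast_nonneg hx.1
    have e1 : ((n + 1 : ℕ) : ℝ) + x = n + x + 1 := by push_cast; ring
    have e2 : 1 - ((n : ℝ) + x + 1) = 1 - (n + x) - 1 := by ring
    rw [e1, extMinkowskiFun_add_one h0, e2, extMinkowskiFun_sub_one (by linarith), ih h0]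
    ring

theorem extMinkowskiFun_one_sub (t : ℝ) : extMinkowskiFun (1 - t) = 1 - extMinkowskiFun t := by
  rcases le_total 0 t with h | h
  · exact extMinkowskiFun_one_sub_of_nonneg h
  · have := extMinkowskiFun_one_sub_of_nonneg (t := 1 - t) (by linarith)
    rw [sub_sub_cancel] at this
    linarith

theorem extMinkowskiFun_inv_of_one_le {t : ℝ} (ht : 1 ≤ t) :
    extMinkowskiFun (1 / t) = 4 / 3 - extMinkowskiFun t := by
  obtain ⟨n, x, hx, e⟩ := exists_nat_add_fract (sub_nonneg.mpr ht)
  obtain rfl : t = n + x + 1 := by linarith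
  clear e ht
  induction n with
  | zero =>
    have hx' : x ∈ Icc (0 : ℝ) 1 := ⟨hx.1, hx.2.le⟩
    have hx1 : 0 < 1 + x := by linarith [hx.1]
    simp only [Nat.cast_zero, zero_add]
    rw [extMinkowskiFun_add_one hx.1, extMinkowskiFun_of_mem_Icc hx', add_comm x,
      extMinkowskiFun_of_mem_Icc ⟨by positivity, by rw [div_le_one hx1]; linarith [hx.1]⟩,
      minkowski_inv_one_add hx']
    ring
  | succ n ih =>
    -- With `v = t - 1 ≥ 1`, the point `1 / t` is the image of `1 / v` under `x ↦ x / (1 + x)`.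
    set v : ℝ := n + x + 1 with hv
    have hv1 : 1 ≤ v := by
      have := hx.1
      have : (0 : ℝ) ≤ n := n.cast_nonneg
      linarith
    have hv0 : 0 < v := by linarith
    have hm : 1 / v ∈ Icc (0 : ℝ) 1 := ⟨by positivity, by rwa [div_le_one hv0]⟩
    have e1 : ((n + 1 : ℕ) : ℝ) + x + 1 = v + 1 := by push_cast; ring
    have e2 : 1 / (v + 1) = 1 / v / (1 + 1 / v) := by field_simp
    have hM := minkowski_div_one_add hm
    rw [← e2] at hM
    rw [extMinkowskiFun_of_mem_Icc hm] at ih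
    rw [e1, extMinkowskiFun_add_one hv0.le, extMinkowskiFun_of_mem_Icc
      ⟨by positivity, by rw [div_le_one (by linarith)]; linarith⟩, hM]
    linarith

/-- The inversion `t ↦ 1 / t` reverses the mass distribution of the half-line `(0, ∞)`, which has
total mass `2 / 3`. -/
theorem extMinkowskiFun_inv {t : ℝ} (ht : 0 < t) :
    extMinkowskiFun (1 / t) = 4 / 3 - extMinkowskiFun t := by
  rcases le_total 1 t with h | h
  · exact extMinkowskiFun_inv_of_one_le h
  · have := extMinkowskiFun_inv_of_one_le (t := 1 / t) (by rwa [le_div_iff₀ ht, one_mul])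
    rw [one_div_one_div] at this
    linarith

theorem extMinkowskiFun_zero : extMinkowskiFun 0 = 1 / 3 := by
  rw [extMinkowskiFun_of_mem_Icc (by simp), minkowski_zero]; norm_num

theorem extMinkowskiFun_one : extMinkowskiFun 1 = 2 / 3 := by
  rw [extMinkowskiFun_of_mem_Icc (by simp), minkowski_one]; norm_num

theorem extMinkowskiFun_half : extMinkowskiFun (1 / 2) = 1 / 2 := by
  have := extMinkowskiFun_one_sub (1 / 2)
  norm_num at this ⊢
  linarith

/-- The action of `b` on the arc outside its own Farey interval halves the mass. -/
theorem extMinkowskiFun_genB {t : ℝ} (ht : 0 < t) :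
    extMinkowskiFun (0 - 1 / (t - 0)) = (extMinkowskiFun t - 1 / 3) / 2 := by
  have h := extMinkowskiFun_one_sub (1 + 1 / t)
  rw [add_comm (1 : ℝ), extMinkowskiFun_add_one (by positivity), extMinkowskiFun_inv ht] at h
  rw [show (0 : ℝ) - 1 / (t - 0) = 1 - (1 / t + 1) by ring_nf, h]
  ring

/-- The action of `a` on the arc outside its own Farey interval halves the mass. -/
theorem extMinkowskiFun_genA {t : ℝ} (ht : t < 1) :
    extMinkowskiFun (1 - 1 / (t - 1)) = 2 / 3 + extMinkowskiFun t / 2 := by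
  have h : 0 < 1 - t := by linarith
  have e : 1 - 1 / (t - 1) = 1 / (1 - t) + 1 := by
    rw [← neg_sub 1 t, div_neg]; ring
  rw [e, extMinkowskiFun_add_one (by positivity), extMinkowskiFun_inv h, extMinkowskiFun_one_sub]
  ring

/-- The action of `c` on the arc `(1, ∞)` outside its own Farey interval halves the mass. -/
theorem extMinkowskiFun_genC_of_one_lt {t : ℝ} (ht : 1 < t) :
    extMinkowskiFun (1 / 2 - 1 / 4 / (t - 1 / 2)) = extMinkowskiFun t / 2 := by
  obtain ⟨w, hw, rfl⟩ : ∃ w : ℝ, 0 < w ∧ t = w + 1 := ⟨t - 1, by linarith, by ring⟩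
  have h1 : 0 < 1 / w := by positivity
  have e : 1 / 2 - 1 / 4 / (w + 1 - 1 / 2) = 1 / (1 / w + 1 + 1) := by
    have : w + 1 - 1 / 2 ≠ 0 := by linarith
    have : 1 + w * 2 ≠ 0 := by positivity
    field_simp
    ring_nf
    field_simp
    ring
  rw [e, extMinkowskiFun_inv (by positivity), extMinkowskiFun_add_one (by positivity),
    extMinkowskiFun_add_one h1.le, extMinkowskiFun_inv hw, extMinkowskiFun_add_one hw.le]
  ring

/-- The action of `c` on the arc `(-∞, 0)` outside its own Farey interval halves the mass. -/
theorem extMinkowskiFun_genC_of_neg {t : ℝ} (ht : t < 0) :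
    extMinkowskiFun (1 / 2 - 1 / 4 / (t - 1 / 2)) = 1 / 2 + extMinkowskiFun t / 2 := by
  have h := extMinkowskiFun_genC_of_one_lt (t := 1 - t) (by linarith)
  have e : (1 : ℝ) / 2 - 1 / 4 / (t - 1 / 2) = 1 - (1 / 2 - 1 / 4 / (1 - t - 1 / 2)) := by
    rw [show 1 - t - 1 / 2 = -(t - 1 / 2) by ring, div_neg]
    ring
  rw [e, extMinkowskiFun_one_sub, h, extMinkowskiFun_one_sub]
  ring

theorem tendsto_extMinkowskiFun_atTop : Tendsto extMinkowskiFun atTop (𝓝 1) := by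
  have hl : Tendsto (fun t : ℝ => 1 - (1 / 2 : ℝ) ^ ⌊t⌋₊ * 2 / 3) atTop (𝓝 1) := by
    have := (tendsto_pow_atTop_nhds_zero_of_lt_one (r := (1 / 2 : ℝ)) (by norm_num)
      (by norm_num)).comp (tendsto_nat_floor_atTop (α := ℝ))
    simpa using (((this.mul_const 2).div_const 3).const_sub 1)
  refine tendsto_of_tendsto_of_tendsto_of_le_of_le' hl tendsto_const_nhds ?_ ?_
  · filter_upwards [eventually_ge_atTop 0] with t ht
    have h := extMinkowskiFun_nat_add ⌊t⌋₊ (x := t - ⌊t⌋₊)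
      ⟨sub_nonneg.mpr (Nat.floor_le ht), by linarith [Nat.lt_floor_add_one t]⟩
    rw [add_sub_cancel] at h
    rw [h]
    have h0 := minkowski_nonneg (t - ⌊t⌋₊)
    gcongr
    linarith
  · filter_upwards [eventually_ge_atTop 0] with t ht
    obtain ⟨n, x, hx, rfl⟩ := exists_nat_add_fract ht
    rw [extMinkowskiFun_nat_add n hx]
    have h0 := minkowski_le_one x
    have : 0 ≤ (1 / 2 : ℝ) ^ n * (2 - minkowski x) / 3 :=
      div_nonneg (mul_nonneg (by positivity) (by linarith)) (by norm_num)
    linarith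

theorem tendsto_extMinkowskiFun_atBot : Tendsto extMinkowskiFun atBot (𝓝 0) := by
  have h : Tendsto (fun t : ℝ => 1 - t) atBot atTop :=
    tendsto_atTop_add_const_left _ 1 tendsto_neg_atBot_atTop
  have := (tendsto_extMinkowskiFun_atTop.comp h).const_sub 1
  refine (this.congr fun t => ?_).trans (by simp)
  simp only [Function.comp, extMinkowskiFun_one_sub, sub_sub_cancel]

/-- Left continuity at the three poles of the generators, so that these points have no mass. -/
theorem continuousWithinAt_extMinkowskiFun_Iic {p : ℝ} (hp : p ∈ Icc (0 : ℝ) 1) :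
    ContinuousWithinAt extMinkowskiFun (Iic p) p := by
  -- On `(0, 1]` the formula on `[0, 1]` holds to the left; the point `0` is a translate of `1`.
  have key {p : ℝ} (hp : p ∈ Ioc (0 : ℝ) 1) : ContinuousWithinAt extMinkowskiFun (Iic p) p := by
    have hc : ContinuousWithinAt (fun t => (1 + minkowski t) / 3) (Iic p) p := by
      have := minkowski_continuous
      exact Continuous.continuousWithinAt (by fun_prop)
    refine hc.congr_of_eventuallyEq ?_ (extMinkowskiFun_of_mem_Icc ⟨hp.1.le, hp.2⟩)
    filter_upwards [Ioc_mem_nhdsLE hp.1] with t ht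
    exact extMinkowskiFun_of_mem_Icc ⟨ht.1.le, ht.2.trans hp.2⟩
  rcases hp.1.eq_or_lt with rfl | h
  · have h1 : ContinuousWithinAt (fun t : ℝ => extMinkowskiFun (t + 1) / 2) (Iic 0) 0 := by
      refine ContinuousWithinAt.div_const ?_ 2
      have h2 := key (p := 0 + 1) (by simp)
      exact h2.comp (g := extMinkowskiFun) (f := fun t => t + 1) (by fun_prop)
        fun t (ht : t ≤ 0) => show t + 1 ≤ 0 + 1 by linarith
    refine h1.congr (fun t ht => ?_) ?_
    · rw [← extMinkowskiFun_sub_one (by simpa using ht), add_sub_cancel_right]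
    · rw [← extMinkowskiFun_sub_one (by simp), add_sub_cancel_right]
  · exact key ⟨h, hp.2⟩

/-! ### Stationarity of the extended Minkowski measure on the line -/

instance : IsProbabilityMeasure extMinkowski.measure :=
  StieltjesFunction.isProbabilityMeasure _ tendsto_extMinkowskiFun_atBot
    tendsto_extMinkowskiFun_atTop

theorem leftLim_extMinkowski {p : ℝ} (hp : p ∈ Icc (0 : ℝ) 1) :
    Function.leftLim extMinkowski p = extMinkowskiFun p :=
  extMinkowskiFun_mono.continuousWithinAt_Iio_iff_leftLim_eq.mp
    ((continuousWithinAt_extMinkowskiFun_Iic hp).mono Iio_subset_Iic_self)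

theorem measure_singleton_extMinkowski {p : ℝ} (hp : p ∈ Icc (0 : ℝ) 1) :
    extMinkowski.measure {p} = 0 := by
  rw [StieltjesFunction.measure_singleton, leftLim_extMinkowski hp]
  exact ENNReal.ofReal_eq_zero.mpr (sub_self _).le

/-- The involution of determinant `k` with pole `p`, in the affine coordinate; it increases on
each side of `p` and exchanges the two sides. At `p` it has the junk value `p`. -/
noncomputable def involution (p k t : ℝ) : ℝ := p - k / (t - p)

theorem measurable_involution (p k : ℝ) : Measurable (involution p k) := by
  unfold involution
  fun_prop

theorem involution_involution {p k : ℝ} (hk : k ≠ 0) (t : ℝ) :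
    involution p k (involution p k t) = t := by
  unfold involution
  rw [show p - k / (t - p) - p = -(k / (t - p)) by ring, div_neg, div_div_cancel₀ hk]
  ring

/-- The distribution function of the image of the extended Minkowski measure under an
involution. -/
noncomputable def involutionCdf (p k x : ℝ) : ℝ :=
  if x < p then extMinkowskiFun (involution p k x) - extMinkowskiFun p
  else if x = p then 1 - extMinkowskiFun p
  else extMinkowskiFun (involution p k x) + (1 - extMinkowskiFun p)

theorem extMinkowskiFun_nonneg (x : ℝ) : 0 ≤ extMinkowskiFun x :=
  extMinkowskiFun_mono.le_of_tendsto tendsto_extMinkowskiFun_atBot x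

theorem extMinkowskiFun_le_one (x : ℝ) : extMinkowskiFun x ≤ 1 :=
  extMinkowskiFun_mono.ge_of_tendsto tendsto_extMinkowskiFun_atTop x

theorem involutionCdf_nonneg {p k : ℝ} (hk : 0 < k) (x : ℝ) : 0 ≤ involutionCdf p k x := by
  unfold involutionCdf
  split_ifs with h1 h2
  · have h : x - p < 0 := by linarith
    have : p ≤ involution p k x := by
      have := div_neg_of_pos_of_neg hk h
      unfold involution
      linarith
    exact sub_nonneg.mpr (extMinkowskiFun_mono this)
  · exact sub_nonneg.mpr (extMinkowskiFun_le_one p)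
  · exact add_nonneg (extMinkowskiFun_nonneg _) (sub_nonneg.mpr (extMinkowskiFun_le_one p))

theorem map_involution_Iic {p k : ℝ} (hp : p ∈ Icc (0 : ℝ) 1) (hk : 0 < k) (x : ℝ) :
    extMinkowski.measure.map (involution p k) (Iic x) = ENNReal.ofReal (involutionCdf p k x) := by
  rw [Measure.map_apply (measurable_involution p k) measurableSet_Iic]
  -- The sign of `involution p k t - p` is opposite to that of `t - p`.
  have hlt {t : ℝ} (h : t < p) : p < involution p k t := by
    have := div_neg_of_pos_of_neg hk (sub_neg.mpr h)
    unfold involution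
    linarith
  have hgt {t : ℝ} (h : p < t) : involution p k t < p := by
    have := div_pos hk (sub_pos.mpr h)
    unfold involution
    linarith
  have hself : involution p k p = p := by simp [involution]
  have hIci : extMinkowski.measure (Ici p) = ENNReal.ofReal (1 - extMinkowskiFun p) := by
    rw [StieltjesFunction.measure_Ici _ tendsto_extMinkowskiFun_atTop, leftLim_extMinkowski hp]
  unfold involutionCdf
  split_ifs with h1 h2
  · have e : involution p k ⁻¹' Iic x = Ioc p (involution p k x) := by
      ext t
      simp only [mem_preimage, mem_Iic, mem_Ioc]
      rcases lt_trichotomy t p with h | rfl | h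
      · have := hlt h
        constructor <;> intro h' <;> [linarith; linarith [h'.1]]
      · rw [hself]
        constructor <;> intro h' <;> [linarith; linarith [h'.1]]
      · simp only [h, true_and]
        have h3 : 0 < t - p := sub_pos.mpr h
        have h4 : 0 < p - x := sub_pos.mpr h1
        unfold involution
        rw [← neg_sub p x, div_neg, sub_neg_eq_add, ← sub_le_iff_le_add', le_div_iff₀ h4,
          sub_le_comm, le_div_iff₀ h3, mul_comm]
    rw [e, StieltjesFunction.measure_Ioc]
    rfl
  · rw [← hIci, h2]
    congr 1
    ext t
    simp only [mem_preimage, mem_Iic, mem_Ici]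
    rcases lt_trichotomy t p with h | rfl | h
    · have := hlt h
      constructor <;> intro h' <;> linarith
    · simp [hself]
    · simp [h.le, (hgt h).le]
  · have h3 : p < x := lt_of_le_of_ne (not_lt.mp h1) (Ne.symm h2)
    have e : involution p k ⁻¹' Iic x = Iic (involution p k x) ∪ Ici p := by
      ext t
      simp only [mem_preimage, mem_Iic, mem_union, mem_Ici]
      rcases lt_or_ge t p with h | h
      · simp only [h.not_ge, or_false]
        have h4 : 0 < p - t := sub_pos.mpr h
        have h5 : 0 < x - p := sub_pos.mpr h3
        unfold involution
        rw [← neg_sub p t, div_neg, sub_neg_eq_add, ← le_sub_iff_add_le', div_le_iff₀ h4,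
          le_sub_comm, div_le_iff₀ h5, mul_comm]
      · simp only [h, or_true, iff_true]
        rcases h.eq_or_lt with rfl | h
        · rw [hself]; exact h3.le
        · exact (hgt h).le.trans h3.le
    have hd : Disjoint (Iic (involution p k x)) (Ici p) := by
      rw [Set.disjoint_left]
      intro t ht ht'
      exact absurd (hgt h3) (not_lt.mpr (le_trans ht' ht))
    rw [e, measure_union hd measurableSet_Ici, hIci,
      StieltjesFunction.measure_Iic _ tendsto_extMinkowskiFun_atBot, sub_zero]
    exact (ENNReal.ofReal_add (extMinkowskiFun_nonneg _)
      (sub_nonneg.mpr (extMinkowskiFun_le_one p))).symm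

/-- On its own Farey interval each generator doubles the mass, and on the complement it halves
it. Apart from `0`, `1` and `∞`, each point lies in the interval of exactly one generator, and
`(2 + 1/2 + 1/2) / 3 = 1`. -/
theorem involutionCdf_add (x : ℝ) :
    involutionCdf 1 1 x + involutionCdf 0 1 x + involutionCdf (1 / 2) (1 / 4) x =
      3 * extMinkowskiFun x := by
  have hA {t : ℝ} (ht : t < 1) :
      extMinkowskiFun (involution 1 1 t) = 2 / 3 + extMinkowskiFun t / 2 := extMinkowskiFun_genA ht
  have hB {t : ℝ} (ht : 0 < t) :
      extMinkowskiFun (involution 0 1 t) = (extMinkowskiFun t - 1 / 3) / 2 :=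
    extMinkowskiFun_genB ht
  have hC {t : ℝ} (ht : 1 < t) :
      extMinkowskiFun (involution (1 / 2) (1 / 4) t) = extMinkowskiFun t / 2 :=
    extMinkowskiFun_genC_of_one_lt ht
  have hC' {t : ℝ} (ht : t < 0) :
      extMinkowskiFun (involution (1 / 2) (1 / 4) t) = 1 / 2 + extMinkowskiFun t / 2 :=
    extMinkowskiFun_genC_of_neg ht
  have hA' {t : ℝ} (ht : 1 < t) :
      extMinkowskiFun (involution 1 1 t) = 2 * (extMinkowskiFun t - 2 / 3) := by
    have h : involution 1 1 t < 1 := by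
      have : 0 < 1 / (t - 1) := by have := sub_pos.mpr ht; positivity
      unfold involution; linarith
    have := hA h
    rw [involution_involution one_ne_zero] at this
    linarith
  have hB' {t : ℝ} (ht : t < 0) :
      extMinkowskiFun (involution 0 1 t) = 2 * extMinkowskiFun t + 1 / 3 := by
    have h : 0 < involution 0 1 t := by
      have : 1 / (t - 0) < 0 := div_neg_of_pos_of_neg one_pos (by linarith)
      unfold involution; linarith
    have := hB h
    rw [involution_involution one_ne_zero] at this
    linarith
  have hCl {t : ℝ} (h0 : 0 < t) (h1 : t < 1 / 2) :
      extMinkowskiFun (involution (1 / 2) (1 / 4) t) = 2 * extMinkowskiFun t := by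
    have h : 1 < involution (1 / 2) (1 / 4) t := by
      unfold involution
      rw [← neg_sub (1 / 2) t, div_neg, sub_neg_eq_add, ← sub_lt_iff_lt_add',
        lt_div_iff₀ (by linarith)]
      linarith
    have := hC h
    rw [involution_involution (by norm_num)] at this
    linarith
  have hCr {t : ℝ} (h0 : 1 / 2 < t) (h1 : t < 1) :
      extMinkowskiFun (involution (1 / 2) (1 / 4) t) = 2 * extMinkowskiFun t - 1 := by
    have h : involution (1 / 2) (1 / 4) t < 0 := by
      unfold involution
      rw [sub_neg, lt_div_iff₀ (by linarith)]
      linarith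
    have := hC' h
    rw [involution_involution (by norm_num)] at this
    linarith
  -- The generator `c` exchanges `0` and `1`.
  have hC0 : involution (1 / 2) (1 / 4) 0 = 1 := by norm_num [involution]
  have hC1 : involution (1 / 2) (1 / 4) 1 = 0 := by norm_num [involution]
  have f0 := extMinkowskiFun_zero
  have f1 := extMinkowskiFun_one
  have fh := extMinkowskiFun_half
  unfold involutionCdf
  rcases lt_trichotomy x 0 with h | rfl | h
  · rw [if_pos (by linarith), if_pos h, if_pos (by linarith), hA (by linarith), hB' h, hC' h]
    linarith
  · rw [if_pos one_pos, if_neg (lt_irrefl _), if_pos rfl, if_pos (by norm_num), hA one_pos, hC0]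
    linarith
  rw [if_neg h.not_gt, if_neg h.ne', hB h]
  rcases lt_trichotomy x 1 with h1 | rfl | h1
  · rw [if_pos h1, hA h1]
    rcases lt_trichotomy x (1 / 2) with h2 | rfl | h2
    · rw [if_pos h2, hCl h h2]
      linarith
    · rw [if_neg (lt_irrefl _), if_pos rfl]
      linarith
    · rw [if_neg h2.not_gt, if_neg h2.ne', hCr h2 h1]
      linarith
  · rw [if_neg (lt_irrefl _), if_pos rfl, if_neg (by norm_num), if_neg (by norm_num), hC1]
    linarith
  · rw [if_neg h1.not_gt, if_neg h1.ne', if_neg (by linarith), if_neg (by linarith), hA' h1, hC h1]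
    linarith

theorem map_involution_add :
    extMinkowski.measure.map (involution 1 1) + extMinkowski.measure.map (involution 0 1) +
      extMinkowski.measure.map (involution (1 / 2) (1 / 4)) = (3 : ℝ≥0∞) • extMinkowski.measure := by
  have h (p k : ℝ) : IsFiniteMeasure (extMinkowski.measure.map (involution p k)) := inferInstance
  refine Measure.ext_of_Iic _ _ fun x => ?_
  simp only [Measure.add_apply, Measure.smul_apply, smul_eq_mul]
  have hn1 := involutionCdf_nonneg (p := 1) one_pos x
  have hn2 := involutionCdf_nonneg (p := 0) one_pos x
  have hn3 := involutionCdf_nonneg (p := 1 / 2) (k := 1 / 4) (by norm_num) x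
  rw [map_involution_Iic (by simp) one_pos, map_involution_Iic (by simp) one_pos,
    map_involution_Iic (by norm_num) (by norm_num), ← ENNReal.ofReal_add hn1 hn2,
    ← ENNReal.ofReal_add (add_nonneg hn1 hn2) hn3, involutionCdf_add,
    StieltjesFunction.measure_Iic _ tendsto_extMinkowskiFun_atBot, sub_zero,
    ENNReal.ofReal_mul (by norm_num), ENNReal.ofReal_ofNat]
  rfl

/-! ### Contraction of the averaging operator on the projective line -/

/-- The positive quadratic form `x² - x y + y²`, which is invariant under the rotation of order
three `(x, y) ↦ (y, y - x)` that permutes the generators of the Farey group by conjugation. -/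
def quadForm (v : Fin 2 → ℝ) : ℝ := v 0 ^ 2 - v 0 * v 1 + v 1 ^ 2

theorem quadForm_pos {v : Fin 2 → ℝ} (hv : v ≠ 0) : 0 < quadForm v := by
  have h : v 0 ≠ 0 ∨ v 1 ≠ 0 := by
    by_contra! h
    exact hv (by ext i; fin_cases i <;> simp [h.1, h.2])
  unfold quadForm
  rcases h with h | h <;> have := sq_pos_of_ne_zero h
  · nlinarith [sq_nonneg (v 0 - 2 * v 1)]
  · nlinarith [sq_nonneg (2 * v 0 - v 1)]

/-- The linear action of `matA` on the plane. -/
def vecA (v : Fin 2 → ℝ) : Fin 2 → ℝ := ![v 0 - 2 * v 1, v 0 - v 1]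

/-- The linear action of `matB` on the plane. -/
def vecB (v : Fin 2 → ℝ) : Fin 2 → ℝ := ![-v 1, v 0]

/-- The linear action of `matC` on the plane. -/
def vecC (v : Fin 2 → ℝ) : Fin 2 → ℝ := ![v 0 - v 1, 2 * v 0 - v 1]

/-- The quadratic polynomial agrees with `u ↦ u ^ (-1/3)` to first order at `64/27` and to order
zero at `8/27 < 1/3`; it is a majorant to the right of `8/27`. -/
theorem rpow_neg_third_le {u : ℝ} (hu : 1 / 3 ≤ u) :
    u ^ (-(1 / 3) : ℝ) ≤ 83 / 49 - 8667 / 12544 * u + 12393 / 100352 * u ^ 2 := by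
  have hu0 : 0 < u := by linarith
  set r : ℝ := u ^ (1 / 3 : ℝ) with hr
  have hr0 : 0 < r := Real.rpow_pos_of_pos hu0 _
  have hr3 : r ^ 3 = u := by
    rw [hr, ← Real.rpow_natCast, ← Real.rpow_mul hu0.le]
    norm_num
  have hr23 : 2 / 3 ≤ r := by
    by_contra! h
    have : r ^ 3 < (2 / 3) ^ 3 := by gcongr
    rw [hr3] at this
    norm_num at this
    linarith
  rw [Real.rpow_neg hu0.le, ← hr, inv_le_iff_one_le_mul₀ hr0, ← hr3, ← sub_nonneg]
  have e : (83 / 49 - 8667 / 12544 * r ^ 3 + 12393 / 100352 * (r ^ 3) ^ 2) * r - 1 =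
      (r - 4 / 3) ^ 2 * (r - 2 / 3) *
        (12393 / 100352 * r ^ 4 + 20655 / 50176 * r ^ 3 + 23409 / 25088 * r ^ 2 +
          54 / 49 * r + 27 / 32) := by ring
  rw [e]
  have := sub_nonneg.mpr hr23
  positivity

/-- The contraction factor of the averaged distance: the average of the quadratic bound in
`rpow_neg_third_le` over three numbers with sum `5` and sum of squares `11`. -/
noncomputable def rate : ℝ := 299595 / 301056

/-- The ratios `Q (g v) / Q v` over the generators `g` have sum `5` and sum of squares `11`, so the
quadratic bound for `u ^ (-1/3)` averages to a constant below `1`. -/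
theorem sum_rpow_quadForm_le {v : Fin 2 → ℝ} (hv : v ≠ 0) :
    ((quadForm (vecA v) / quadForm v) ^ (-(1 / 3) : ℝ) +
      (quadForm (vecB v) / quadForm v) ^ (-(1 / 3) : ℝ) +
      (quadForm (vecC v) / quadForm v) ^ (-(1 / 3) : ℝ)) ≤ 3 * rate := by
  have hQ := quadForm_pos hv
  have h1 {q : ℝ} (h : quadForm v ≤ 3 * q) : 1 / 3 ≤ q / quadForm v := by
    rw [le_div_iff₀ hQ]; linarith
  have hA := rpow_neg_third_le (h1 (q := quadForm (vecA v)) (by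
    simp only [quadForm, vecA, Matrix.cons_val_zero, Matrix.cons_val_one]
    nlinarith [sq_nonneg (v 0 - 2 * v 1)]))
  have hB := rpow_neg_third_le (h1 (q := quadForm (vecB v)) (by
    simp only [quadForm, vecB, Matrix.cons_val_zero, Matrix.cons_val_one]
    nlinarith [sq_nonneg (v 0 + v 1)]))
  have hC := rpow_neg_third_le (h1 (q := quadForm (vecC v)) (by
    simp only [quadForm, vecC, Matrix.cons_val_zero, Matrix.cons_val_one]
    nlinarith [sq_nonneg (2 * v 0 - v 1)]))
  have hs1 : quadForm (vecA v) / quadForm v + quadForm (vecB v) / quadForm v +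
      quadForm (vecC v) / quadForm v = 5 := by
    rw [← add_div, ← add_div, div_eq_iff hQ.ne']
    simp only [quadForm, vecA, vecB, vecC, Matrix.cons_val_zero, Matrix.cons_val_one]
    ring
  have hs2 : (quadForm (vecA v) / quadForm v) ^ 2 + (quadForm (vecB v) / quadForm v) ^ 2 +
      (quadForm (vecC v) / quadForm v) ^ 2 = 11 := by
    rw [div_pow, div_pow, div_pow, ← add_div, ← add_div, div_eq_iff (pow_ne_zero 2 hQ.ne')]
    simp only [quadForm, vecA, vecB, vecC, Matrix.cons_val_zero, Matrix.cons_val_one]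
    ring
  unfold rate
  linarith

/-- The determinant of two vectors. -/
def det₂ (v w : Fin 2 → ℝ) : ℝ := v 0 * w 1 - v 1 * w 0

/-- The snowflaked projective distance `(det(v, w)² / (Q v Q w)) ^ (1/6)`; the bracket is the
squared sine of an angle, up to a constant factor. -/
noncomputable def vecDist (v w : Fin 2 → ℝ) : ℝ :=
  (det₂ v w ^ 2 / (quadForm v * quadForm w)) ^ (1 / 6 : ℝ)

theorem quadForm_nonneg (v : Fin 2 → ℝ) : 0 ≤ quadForm v := by
  unfold quadForm
  nlinarith [sq_nonneg (v 0 - v 1), sq_nonneg (v 0), sq_nonneg (v 1)]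

theorem vecDist_nonneg (v w : Fin 2 → ℝ) : 0 ≤ vecDist v w := by
  have := quadForm_nonneg v
  have := quadForm_nonneg w
  unfold vecDist
  positivity

theorem vecDist_smul {r s : ℝ} (hr : r ≠ 0) (hs : s ≠ 0) (v w : Fin 2 → ℝ) :
    vecDist (r • v) (s • w) = vecDist v w := by
  unfold vecDist
  congr 1
  have h1 : det₂ (r • v) (s • w) ^ 2 = (r ^ 2 * s ^ 2) * det₂ v w ^ 2 := by
    simp only [det₂, Pi.smul_apply, smul_eq_mul]; ring
  have h2 : quadForm (r • v) * quadForm (s • w) = (r ^ 2 * s ^ 2) * (quadForm v * quadForm w) := by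
    simp only [quadForm, Pi.smul_apply, smul_eq_mul]; ring
  rw [h1, h2, mul_div_mul_left _ _ (by positivity)]

theorem vecDist_le_two {v w : Fin 2 → ℝ} (hv : v ≠ 0) (hw : w ≠ 0) : vecDist v w ≤ 2 := by
  have hq := mul_pos (quadForm_pos hv) (quadForm_pos hw)
  have h : det₂ v w ^ 2 / (quadForm v * quadForm w) ≤ 2 ^ (6 : ℝ) := by
    rw [div_le_iff₀ hq]
    have e : 4 * (quadForm v * quadForm w) = 3 * det₂ v w ^ 2 +
        (2 * v 0 * w 0 - v 0 * w 1 - v 1 * w 0 + 2 * v 1 * w 1) ^ 2 := by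
      simp only [quadForm, det₂]; ring
    norm_num
    nlinarith [sq_nonneg (2 * v 0 * w 0 - v 0 * w 1 - v 1 * w 0 + 2 * v 1 * w 1)]
  calc vecDist v w ≤ ((2 : ℝ) ^ (6 : ℝ)) ^ (1 / 6 : ℝ) :=
        Real.rpow_le_rpow (by positivity) h (by norm_num)
    _ = 2 := by rw [← Real.rpow_mul (by norm_num)]; norm_num

/-- Maps preserving the determinant distort the projective distance by factors depending on each
point separately; the geometric mean of these is at most the arithmetic mean. -/
theorem vecDist_map_le {g : (Fin 2 → ℝ) → Fin 2 → ℝ} {v w : Fin 2 → ℝ} (hv : v ≠ 0) (hw : w ≠ 0)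
    (hgv : g v ≠ 0) (hgw : g w ≠ 0) (hdet : det₂ (g v) (g w) = det₂ v w) :
    vecDist (g v) (g w) ≤ ((quadForm (g v) / quadForm v) ^ (-(1 / 3) : ℝ) +
      (quadForm (g w) / quadForm w) ^ (-(1 / 3) : ℝ)) / 2 * vecDist v w := by
  have hv' := quadForm_pos hv
  have hw' := quadForm_pos hw
  have hgv' := quadForm_pos hgv
  have hgw' := quadForm_pos hgw
  set p := quadForm (g v) / quadForm v with hp
  set q := quadForm (g w) / quadForm w with hq
  have hp0 : 0 < p := div_pos hgv' hv'
  have hq0 : 0 < q := div_pos hgw' hw'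
  have e : det₂ (g v) (g w) ^ 2 / (quadForm (g v) * quadForm (g w)) =
      p⁻¹ * q⁻¹ * (det₂ v w ^ 2 / (quadForm v * quadForm w)) := by
    rw [hdet, hp, hq]
    field_simp
  have e3 {p : ℝ} (hp : 0 < p) : p ^ (-(1 / 3) : ℝ) = ((p⁻¹) ^ (1 / 6 : ℝ)) ^ 2 := by
    rw [← Real.rpow_natCast, ← Real.rpow_mul (inv_nonneg.mpr hp.le), Real.inv_rpow hp.le,
      ← Real.rpow_neg hp.le]
    norm_num
  have hd := vecDist_nonneg v w
  rw [vecDist, e, Real.mul_rpow (by positivity) (by positivity),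
    Real.mul_rpow (by positivity) (by positivity), e3 hp0, e3 hq0]
  refine mul_le_mul_of_nonneg_right ?_ hd
  nlinarith [sq_nonneg (p⁻¹ ^ (1 / 6 : ℝ) - q⁻¹ ^ (1 / 6 : ℝ))]

theorem vecA_ne_zero {v : Fin 2 → ℝ} (hv : v ≠ 0) : vecA v ≠ 0 := by
  intro h
  apply hv
  have h0 := congrFun h 0
  have h1 := congrFun h 1
  simp only [vecA, Matrix.cons_val_zero, Matrix.cons_val_one, Pi.zero_apply] at h0 h1
  ext i
  fin_cases i
  · change v 0 = 0; linarith
  · change v 1 = 0; linarith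

theorem vecB_ne_zero {v : Fin 2 → ℝ} (hv : v ≠ 0) : vecB v ≠ 0 := by
  intro h
  apply hv
  have h0 := congrFun h 0
  have h1 := congrFun h 1
  simp only [vecB, Matrix.cons_val_zero, Matrix.cons_val_one, Pi.zero_apply] at h0 h1
  ext i
  fin_cases i
  · change v 0 = 0; linarith
  · change v 1 = 0; linarith

theorem vecC_ne_zero {v : Fin 2 → ℝ} (hv : v ≠ 0) : vecC v ≠ 0 := by
  intro h
  apply hv
  have h0 := congrFun h 0
  have h1 := congrFun h 1
  simp only [vecC, Matrix.cons_val_zero, Matrix.cons_val_one, Pi.zero_apply] at h0 h1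
  ext i
  fin_cases i
  · change v 0 = 0; linarith
  · change v 1 = 0; linarith

theorem sum_vecDist_le {v w : Fin 2 → ℝ} (hv : v ≠ 0) (hw : w ≠ 0) :
    vecDist (vecA v) (vecA w) + vecDist (vecB v) (vecB w) + vecDist (vecC v) (vecC w) ≤
      3 * rate * vecDist v w := by
  have hA := vecDist_map_le hv hw (vecA_ne_zero hv) (vecA_ne_zero hw) (by
    simp only [det₂, vecA, Matrix.cons_val_zero, Matrix.cons_val_one]; ring)
  have hB := vecDist_map_le hv hw (vecB_ne_zero hv) (vecB_ne_zero hw) (by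
    simp only [det₂, vecB, Matrix.cons_val_zero, Matrix.cons_val_one]; ring)
  have hC := vecDist_map_le hv hw (vecC_ne_zero hv) (vecC_ne_zero hw) (by
    simp only [det₂, vecC, Matrix.cons_val_zero, Matrix.cons_val_one]; ring)
  have h := mul_le_mul_of_nonneg_right
    (add_le_add (sum_rpow_quadForm_le hv) (sum_rpow_quadForm_le hw)) (vecDist_nonneg v w)
  linarith

theorem mk_smul_proj_mk (A : SL(2, ℤ)) {v w : Fin 2 → ℝ} (hv : v ≠ 0) (hw : w ≠ 0)
    (h : ∀ i, w i = (A.1 i 0 : ℝ) * v 0 + (A.1 i 1 : ℝ) * v 1) :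
    (QuotientGroup.mk A : PSL(2, ℤ)) • Projectivization.mk ℝ v hv = Projectivization.mk ℝ w hw := by
  rw [mk_smul, Projectivization.smul_mk]
  congr 1
  rw [Matrix.SpecialLinearGroup.smul_def, Matrix.smul_eq_mulVec]
  ext i
  rw [h i, Matrix.mulVec, dotProduct, Fin.sum_univ_two]
  rfl

theorem genA_smul_mk {v : Fin 2 → ℝ} (hv : v ≠ 0) :
    genA • Projectivization.mk ℝ v hv = Projectivization.mk ℝ (vecA v) (vecA_ne_zero hv) := by
  refine mk_smul_proj_mk _ _ _ fun i => ?_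
  fin_cases i <;> simp [matA, vecA, sub_eq_add_neg]

theorem genB_smul_mk {v : Fin 2 → ℝ} (hv : v ≠ 0) :
    genB • Projectivization.mk ℝ v hv = Projectivization.mk ℝ (vecB v) (vecB_ne_zero hv) := by
  refine mk_smul_proj_mk _ _ _ fun i => ?_
  fin_cases i <;> simp [matB, vecB]

theorem genC_smul_mk {v : Fin 2 → ℝ} (hv : v ≠ 0) :
    genC • Projectivization.mk ℝ v hv = Projectivization.mk ℝ (vecC v) (vecC_ne_zero hv) := by
  refine mk_smul_proj_mk _ _ _ fun i => ?_
  fin_cases i <;> simp [matC, vecC, sub_eq_add_neg]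

/-- The snowflaked projective distance between points of the projective line. -/
noncomputable def projDist (x y : ProjLine) : ℝ := vecDist x.rep y.rep

theorem projDist_mk {v w : Fin 2 → ℝ} (hv : v ≠ 0) (hw : w ≠ 0) :
    projDist (Projectivization.mk ℝ v hv) (Projectivization.mk ℝ w hw) = vecDist v w := by
  obtain ⟨r, hr⟩ := Projectivization.exists_smul_eq_mk_rep ℝ v hv
  obtain ⟨s, hs⟩ := Projectivization.exists_smul_eq_mk_rep ℝ w hw
  rw [projDist, ← hr, ← hs, Units.smul_def, Units.smul_def, vecDist_smul r.ne_zero s.ne_zero]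

theorem projDist_le_two (x y : ProjLine) : projDist x y ≤ 2 :=
  vecDist_le_two x.rep_nonzero y.rep_nonzero

theorem sum_projDist_le (x y : ProjLine) :
    projDist (genA • x) (genA • y) + projDist (genB • x) (genB • y) +
      projDist (genC • x) (genC • y) ≤ 3 * rate * projDist x y := by
  induction x using Projectivization.ind with
  | h v hv =>
  induction y using Projectivization.ind with
  | h w hw =>
    simp only [genA_smul_mk, genB_smul_mk, genC_smul_mk, projDist_mk]
    exact sum_vecDist_le hv hw

theorem continuous_proj_mk {α : Type*} [TopologicalSpace α] {φ : α → Fin 2 → ℝ} (hφ : Continuous φ)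
    (h0 : ∀ x, φ x ≠ 0) : Continuous fun x => (Projectivization.mk ℝ (φ x) (h0 x) : ProjLine) :=
  continuous_quotient_mk'.comp (hφ.subtype_mk h0)

/-- A continuous function on the projective line is uniformly continuous for the projective
distance, so it is Lipschitz up to any prescribed error. -/
theorem exists_abs_sub_le (f : C(ProjLine, ℝ)) {ε : ℝ} (hε : 0 < ε) :
    ∃ C : ℝ, 0 ≤ C ∧ ∀ x y, |f x - f y| ≤ ε + C * projDist x y := by
  let S := Metric.sphere (0 : Fin 2 → ℝ) 1
  have hS (v : S) : (v : Fin 2 → ℝ) ≠ 0 := ne_zero_of_mem_unit_sphere v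
  have : CompactSpace S := isCompact_iff_compactSpace.mp (isCompact_sphere _ _)
  let F : S × S → ℝ := fun p =>
    |f (Projectivization.mk ℝ p.1 (hS p.1)) - f (Projectivization.mk ℝ p.2 (hS p.2))|
  have hF : Continuous F := by
    have h1 : Continuous fun p : S × S => f (Projectivization.mk ℝ p.1 (hS p.1)) :=
      f.continuous.comp (continuous_proj_mk (by fun_prop) _)
    have h2 : Continuous fun p : S × S => f (Projectivization.mk ℝ p.2 (hS p.2)) :=
      f.continuous.comp (continuous_proj_mk (by fun_prop) _)
    exact (h1.sub h2).abs
  let D : S × S → ℝ := fun p => vecDist p.1 p.2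
  have hD : Continuous D := by
    have hq : Continuous quadForm := by unfold quadForm; fun_prop
    have hd : Continuous fun p : S × S => det₂ p.1 p.2 := by
      have h1 (i : Fin 2) : Continuous fun p : S × S => (p.1 : Fin 2 → ℝ) i :=
        (continuous_apply i).comp (continuous_subtype_val.comp continuous_fst)
      have h2 (i : Fin 2) : Continuous fun p : S × S => (p.2 : Fin 2 → ℝ) i :=
        (continuous_apply i).comp (continuous_subtype_val.comp continuous_snd)
      exact ((h1 0).mul (h2 1)).sub ((h1 1).mul (h2 0))
    refine Continuous.rpow_const (Continuous.div (hd.pow 2) (by fun_prop) fun p => ?_)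
      fun _ => Or.inr (by norm_num)
    exact (mul_pos (quadForm_pos (hS p.1)) (quadForm_pos (hS p.2))).ne'
  have hD0 (p : S × S) (h : D p = 0) : F p = 0 := by
    have hq := mul_pos (quadForm_pos (hS p.1)) (quadForm_pos (hS p.2))
    have h1 := (Real.rpow_eq_zero (by positivity) (by norm_num)).mp h
    have h2 : det₂ p.1 p.2 = 0 := by
      rcases div_eq_zero_iff.mp h1 with h | h
      · exact pow_eq_zero_iff (two_ne_zero) |>.mp h
      · exact absurd h hq.ne'
    have h3 : Projectivization.mk ℝ (p.1 : Fin 2 → ℝ) (hS p.1) =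
        Projectivization.mk ℝ (p.2 : Fin 2 → ℝ) (hS p.2) := by
      obtain ⟨⟨v, hv⟩, ⟨w, hw⟩⟩ := p
      have hw0 : w ≠ 0 := hS ⟨w, hw⟩
      rw [Projectivization.mk_eq_mk_iff']
      simp only [det₂] at h2
      have hor : w 0 ≠ 0 ∨ w 1 ≠ 0 := by
        by_contra! h
        exact hw0 (by ext i; fin_cases i <;> simp [h.1, h.2])
      rcases hor with h | h
      · refine ⟨v 0 / w 0, ?_⟩
        ext i
        fin_cases i
        · change v 0 / w 0 * w 0 = v 0
          field_simp
        · change v 0 / w 0 * w 1 = v 1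
          field_simp
          linarith
      · refine ⟨v 1 / w 1, ?_⟩
        ext i
        fin_cases i
        · change v 1 / w 1 * w 0 = v 0
          field_simp
          linarith
        · change v 1 / w 1 * w 1 = v 1
          field_simp
    simp only [F, h3, sub_self, abs_zero]
  have hDnn (p : S × S) : 0 ≤ D p := vecDist_nonneg _ _
  obtain ⟨C, hC0, hC⟩ : ∃ C : ℝ, 0 ≤ C ∧ ∀ p, F p ≤ ε + C * D p := by
    obtain ⟨B, hB⟩ := (isCompact_univ (X := S × S)).exists_bound_of_continuousOn hF.continuousOn
    have hK : IsCompact {p | ε ≤ F p} := (isClosed_le continuous_const hF).isCompact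
    -- `D` vanishes only where `F` does, so it has a positive minimum on the compact set `ε ≤ F`.
    obtain ⟨η, hη, hη'⟩ : ∃ η > 0, ∀ p, ε ≤ F p → η ≤ D p := by
      rcases {p | ε ≤ F p}.eq_empty_or_nonempty with he | hne
      · exact ⟨1, one_pos, fun p hp => absurd (show p ∈ {p | ε ≤ F p} from hp) (by simp [he])⟩
      · obtain ⟨p, hp, hmin⟩ := hK.exists_isMinOn hne hD.continuousOn
        refine ⟨D p, (hDnn p).lt_of_ne' fun h => ?_, fun q hq => hmin hq⟩
        have : ε ≤ F p := hp
        rw [hD0 p h] at this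
        linarith
    refine ⟨|B| / η, by positivity, fun p => ?_⟩
    rcases lt_or_ge (F p) ε with h | h
    · have := mul_nonneg (show 0 ≤ |B| / η by positivity) (hDnn p)
      linarith
    · have h1 : F p ≤ |B| := (le_abs_self _).trans ((hB p (mem_univ p)).trans (le_abs_self B))
      have h2 : |B| ≤ |B| / η * D p := by
        rw [div_mul_eq_mul_div, le_div_iff₀ hη]
        exact mul_le_mul_of_nonneg_left (hη' p h) (abs_nonneg B)
      linarith
  refine ⟨C, hC0, fun x y => ?_⟩
  have hrep (x : ProjLine) : ∃ v : S, x = Projectivization.mk ℝ (v : Fin 2 → ℝ) (hS v) := by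
    have h0 : ‖x.rep‖ ≠ 0 := norm_ne_zero_iff.mpr x.rep_nonzero
    refine ⟨⟨‖x.rep‖⁻¹ • x.rep, ?_⟩, ?_⟩
    · rw [mem_sphere_zero_iff_norm, norm_smul, norm_inv, norm_norm, inv_mul_cancel₀ h0]
    · conv_lhs => rw [← x.mk_rep]
      rw [Projectivization.mk_eq_mk_iff']
      exact ⟨‖x.rep‖, by simp [smul_smul, mul_inv_cancel₀ h0]⟩
  obtain ⟨v, rfl⟩ := hrep x
  obtain ⟨w, rfl⟩ := hrep y
  rw [projDist_mk]
  exact hC (v, w)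

/-! ### The averaging operator, convolution and stationarity -/

theorem continuous_smul_proj (γ : PSL(2, ℤ)) : Continuous fun x : ProjLine => γ • x := by
  obtain ⟨A, rfl⟩ := QuotientGroup.mk_surjective γ
  let B := Matrix.SpecialLinearGroup.map (Int.castRingHom ℝ) A
  have h : Continuous fun v : {v : Fin 2 → ℝ // v ≠ 0} => B • (v : Fin 2 → ℝ) := by
    simp only [Matrix.SpecialLinearGroup.smul_def, Matrix.smul_eq_mulVec]
    exact Continuous.matrix_mulVec continuous_const continuous_subtype_val
  exact Continuous.quotient_lift
    (continuous_proj_mk h fun v => (smul_ne_zero_iff_ne B).mpr v.2) _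

/-- The Markov operator of the random walk on continuous functions. -/
noncomputable def average (f : C(ProjLine, ℝ)) : C(ProjLine, ℝ) where
  toFun x := (f (genA • x) + f (genB • x) + f (genC • x)) / 3
  continuous_toFun := by
    have hA := continuous_smul_proj genA
    have hB := continuous_smul_proj genB
    have hC := continuous_smul_proj genC
    fun_prop

theorem average_apply (f : C(ProjLine, ℝ)) (x : ProjLine) :
    average f x = (f (genA • x) + f (genB • x) + f (genC • x)) / 3 := rfl

theorem abs_average_iterate_sub_le {f : C(ProjLine, ℝ)} {ε C : ℝ} (hC : 0 ≤ C)
    (h : ∀ x y, |f x - f y| ≤ ε + C * projDist x y) (n : ℕ) (x y : ProjLine) :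
    |average^[n] f x - average^[n] f y| ≤ ε + C * rate ^ n * projDist x y := by
  induction n generalizing x y with
  | zero => simpa using h x y
  | succ n ih =>
    rw [Function.iterate_succ_apply', average_apply, average_apply]
    set g := average^[n] f
    have hA := abs_le.mp (ih (genA • x) (genA • y))
    have hB := abs_le.mp (ih (genB • x) (genB • y))
    have hC' := abs_le.mp (ih (genC • x) (genC • y))
    have hr : 0 ≤ C * rate ^ n := mul_nonneg hC (pow_nonneg (by norm_num [rate]) n)
    have hs := mul_le_mul_of_nonneg_left (sum_projDist_le x y) hr
    have e : C * rate ^ (n + 1) * projDist x y =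
        C * rate ^ n * (3 * rate * projDist x y) / 3 := by ring
    rw [e, abs_le]
    constructor <;> linarith [hA.1, hA.2, hB.1, hB.2, hC'.1, hC'.2]

theorem exists_norm_le (f : C(ProjLine, ℝ)) : ∃ B, ∀ x, ‖f x‖ ≤ B := by
  obtain ⟨C, hC0, hC⟩ := exists_abs_sub_le f one_pos
  let x₀ := affineChart 0
  refine ⟨1 + C * 2 + ‖f x₀‖, fun x => ?_⟩
  have h1 := hC x x₀
  have h2 := mul_le_mul_of_nonneg_left (projDist_le_two x x₀) hC0
  have h3 := norm_sub_norm_le (f x) (f x₀)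
  rw [Real.norm_eq_abs (f x - f x₀)] at h3
  linarith

theorem integrable_of_continuous (f : C(ProjLine, ℝ)) (ρ : Measure ProjLine) [IsFiniteMeasure ρ] :
    Integrable f ρ := by
  obtain ⟨B, hB⟩ := exists_norm_le f
  exact Integrable.of_bound f.continuous.measurable.aestronglyMeasurable B (ae_of_all _ hB)

instance : Countable fareyGroup := by
  have : Countable SL(2, ℤ) := by
    have : Countable (Matrix (Fin 2) (Fin 2) ℤ) := inferInstanceAs (Countable (Fin 2 → Fin 2 → ℤ))
    exact Subtype.countable
  have : Countable PSL(2, ℤ) :=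
    (QuotientGroup.mk_surjective (s := Subgroup.center SL(2, ℤ))).countable
  exact Subtype.countable

theorem measurable_smul_proj :
    Measurable fun p : fareyGroup × ProjLine => p.1 • p.2 :=
  measurable_from_prod_countable_right fun γ => (continuous_smul_proj γ.1).measurable

theorem measurable_farey_mul : Measurable fun p : fareyGroup × fareyGroup => p.1 * p.2 :=
  measurable_from_prod_countable_right fun _ => measurable_from_top

instance : IsProbabilityMeasure stepMeasure := ⟨by
  simp only [stepMeasure, Measure.smul_apply, Measure.add_apply, measure_univ, smul_eq_mul]
  rw [one_add_one_eq_two, show (2 : ℝ≥0∞) + 1 = 3 by norm_num]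
  exact ENNReal.inv_mul_cancel (by norm_num) (by norm_num)⟩

instance (n : ℕ) : IsProbabilityMeasure (convPow stepMeasure n) := by
  induction n with
  | zero => exact Measure.dirac.isProbabilityMeasure
  | succ n ih => exact Measure.isProbabilityMeasure_map measurable_farey_mul.aemeasurable

instance (μ : Measure fareyGroup) (ρ : Measure ProjLine) [IsProbabilityMeasure μ]
    [IsProbabilityMeasure ρ] : IsProbabilityMeasure (actConv μ ρ) :=
  Measure.isProbabilityMeasure_map measurable_smul_proj.aemeasurable

theorem actConv_dirac (γ : fareyGroup) (ρ : Measure ProjLine) [SFinite ρ] :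
    actConv (Measure.dirac γ) ρ = ρ.map fun x => γ • x := by
  rw [actConv, Measure.dirac_prod, Measure.map_map measurable_smul_proj (by fun_prop)]
  rfl

theorem actConv_mconv (μ κ : Measure fareyGroup) (ρ : Measure ProjLine) [IsProbabilityMeasure μ]
    [IsProbabilityMeasure κ] [IsProbabilityMeasure ρ] :
    actConv (Measure.mconv μ κ) ρ = actConv μ (actConv κ ρ) := by
  have h1 : (Measure.mconv μ κ).prod ρ =
      ((μ.prod κ).prod ρ).map (Prod.map (fun p => p.1 * p.2) id) := by
    rw [← Measure.map_prod_map _ _ measurable_farey_mul measurable_id, Measure.map_id]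
    rfl
  have h2 : μ.prod (actConv κ ρ) =
      (μ.prod (κ.prod ρ)).map (Prod.map id fun p => p.1 • p.2) := by
    rw [← Measure.map_prod_map _ _ measurable_id measurable_smul_proj, Measure.map_id]
    rfl
  rw [actConv, h1, actConv.eq_def μ, h2, Measure.map_map measurable_smul_proj
    (measurable_farey_mul.prodMap measurable_id), Measure.map_map measurable_smul_proj
    (measurable_id.prodMap measurable_smul_proj),
    ← (measurePreserving_prodAssoc μ κ ρ).map_eq, Measure.map_map
    (measurable_smul_proj.comp (measurable_id.prodMap measurable_smul_proj))
    MeasurableEquiv.prodAssoc.measurable]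
  congr 1
  ext1 p
  exact mul_smul p.1.1 p.1.2 p.2

theorem integral_actConv_stepMeasure (f : C(ProjLine, ℝ)) (ρ : Measure ProjLine)
    [IsProbabilityMeasure ρ] :
    ∫ x, f x ∂(actConv stepMeasure ρ) = ∫ x, average f x ∂ρ := by
  have hm (γ : fareyGroup) : Measurable fun x : ProjLine => γ • x :=
    (continuous_smul_proj γ.1).measurable
  have e : actConv stepMeasure ρ =
      (3⁻¹ : ℝ≥0∞) • (ρ.map (fun x => a • x) + ρ.map (fun x => b • x) + ρ.map fun x => c • x) := by
    rw [← actConv_dirac, ← actConv_dirac, ← actConv_dirac]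
    simp only [actConv, stepMeasure]
    rw [Measure.prod_smul_left, Measure.add_prod, Measure.add_prod, Measure.map_smul,
      Measure.map_add _ _ measurable_smul_proj, Measure.map_add _ _ measurable_smul_proj]
  have hi (γ : fareyGroup) : Integrable f (ρ.map fun x => γ • x) := by
    have := Measure.isProbabilityMeasure_map (μ := ρ) (hm γ).aemeasurable
    exact integrable_of_continuous f _
  have hi' (γ : fareyGroup) : Integrable (fun x => f (γ • x)) ρ :=
    (integrable_map_measure f.continuous.aestronglyMeasurable (hm γ).aemeasurable).mp (hi γ)
  have hint (γ : fareyGroup) : ∫ x, f x ∂(ρ.map fun x => γ • x) = ∫ x, f (γ • x) ∂ρ :=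
    integral_map (hm γ).aemeasurable f.continuous.aestronglyMeasurable
  have hab : Integrable (fun x => f (a • x) + f (b • x)) ρ := (hi' a).add (hi' b)
  rw [e, integral_smul_measure, integral_add_measure ((hi a).add_measure (hi b)) (hi c),
    integral_add_measure (hi a) (hi b), hint, hint, hint, ← integral_add (hi' a) (hi' b),
    ← integral_add hab (hi' c), ← integral_smul]
  congr 1
  ext1 x
  rw [ENNReal.toReal_inv, ENNReal.toReal_ofNat, smul_eq_mul, average_apply, div_eq_inv_mul]
  rfl

theorem integral_actConv_convPow (π : Measure ProjLine) [IsProbabilityMeasure π] (n : ℕ)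
    (f : C(ProjLine, ℝ)) :
    ∫ x, f x ∂(actConv (convPow stepMeasure n) π) = ∫ x, average^[n] f x ∂π := by
  induction n generalizing f with
  | zero =>
    have : actConv (convPow stepMeasure 0) π = π := by
      rw [convPow, actConv_dirac]
      simp only [one_smul, Measure.map_id']
    rw [this]
    rfl
  | succ n ih =>
    rw [convPow, actConv_mconv, integral_actConv_stepMeasure, ih]
    rfl

theorem continuous_affineChart : Continuous affineChart :=
  continuous_proj_mk (by fun_prop) fun t => by simp

instance : IsProbabilityMeasure extMinkowskiMeasure :=
  Measure.isProbabilityMeasure_map continuous_affineChart.measurable.aemeasurable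

theorem affineChart_eq_mk {v : Fin 2 → ℝ} (hv : v ≠ 0) (h1 : v 1 ≠ 0) {t : ℝ}
    (ht : t = v 0 / v 1) : Projectivization.mk ℝ v hv = affineChart t := by
  rw [affineChart, Projectivization.mk_eq_mk_iff']
  refine ⟨v 1, ?_⟩
  ext i
  fin_cases i
  · change v 1 * t = v 0
    rw [ht]
    field_simp
  · change v 1 * 1 = v 1
    rw [mul_one]

theorem genA_smul_affineChart {t : ℝ} (ht : t ≠ 1) :
    genA • affineChart t = affineChart (involution 1 1 t) := by
  have h : t - 1 ≠ 0 := sub_ne_zero.mpr ht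
  rw [affineChart, genA_smul_mk]
  refine affineChart_eq_mk _ (by simpa [vecA] using h) ?_
  simp only [vecA, involution, Matrix.cons_val_zero, Matrix.cons_val_one]
  field_simp
  ring

theorem genB_smul_affineChart {t : ℝ} (ht : t ≠ 0) :
    genB • affineChart t = affineChart (involution 0 1 t) := by
  rw [affineChart, genB_smul_mk]
  refine affineChart_eq_mk _ (by simpa [vecB] using ht) ?_
  simp only [vecB, involution, Matrix.cons_val_zero, Matrix.cons_val_one]
  ring

theorem genC_smul_affineChart {t : ℝ} (ht : t ≠ 1 / 2) :
    genC • affineChart t = affineChart (involution (1 / 2) (1 / 4) t) := by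
  have h : t - 1 / 2 ≠ 0 := sub_ne_zero.mpr ht
  have h2 : 2 * t - 1 ≠ 0 := fun h' => h (by linarith)
  rw [affineChart, genC_smul_mk]
  refine affineChart_eq_mk _ (by simpa [vecC] using h2) ?_
  simp only [vecC, involution, Matrix.cons_val_zero, Matrix.cons_val_one]
  rw [show t - 1 / 2 = (2 * t - 1) / 2 by ring]
  field_simp
  ring

/-- The extended Minkowski measure is stationary. The three poles, where the affine formulas for
the generators break down, form a null set. -/
theorem integral_average_extMinkowskiMeasure (f : C(ProjLine, ℝ)) :
    ∫ x, average f x ∂extMinkowskiMeasure = ∫ x, f x ∂extMinkowskiMeasure := by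
  set m := extMinkowski.measure with hm
  have hc := continuous_affineChart
  have hfc : Continuous fun t => f (affineChart t) := f.continuous.comp hc
  obtain ⟨B, hB⟩ := exists_norm_le f
  have hint (p k : ℝ) : ∫ t, f (affineChart t) ∂(m.map (involution p k)) =
      ∫ t, f (affineChart (involution p k t)) ∂m :=
    integral_map (measurable_involution p k).aemeasurable hfc.aestronglyMeasurable
  have hi (κ : Measure ℝ) [IsFiniteMeasure κ] : Integrable (fun t => f (affineChart t)) κ :=
    Integrable.of_bound hfc.aestronglyMeasurable B (ae_of_all _ fun t => hB _)
  have hi' (p k : ℝ) : Integrable (fun t => f (affineChart (involution p k t))) m :=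
    (integrable_map_measure hfc.aestronglyMeasurable
      (measurable_involution p k).aemeasurable).mp (hi _)
  have hae {p : ℝ} (hp : p ∈ Icc (0 : ℝ) 1) : ∀ᵐ t ∂m, t ≠ p :=
    compl_mem_ae_iff.mpr (measure_singleton_extMinkowski hp)
  have h1 : ∫ x, average f x ∂extMinkowskiMeasure =
      ∫ t, (f (affineChart (involution 1 1 t)) + f (affineChart (involution 0 1 t)) +
        f (affineChart (involution (1 / 2) (1 / 4) t))) / 3 ∂m := by
    rw [extMinkowskiMeasure, integral_map hc.measurable.aemeasurable
      (average f).continuous.aestronglyMeasurable]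
    refine integral_congr_ae ?_
    filter_upwards [hae (p := 1) (by simp), hae (p := 0) (by simp), hae (p := 1 / 2) (by norm_num)]
      with t ht1 ht0 hth
    rw [average_apply, genA_smul_affineChart ht1, genB_smul_affineChart ht0,
      genC_smul_affineChart hth]
  have hab : Integrable (fun t => f (affineChart (involution 1 1 t)) +
      f (affineChart (involution 0 1 t))) m := (hi' 1 1).add (hi' 0 1)
  rw [h1, integral_div, integral_add hab (hi' _ _),
    integral_add (hi' _ _) (hi' _ _), ← hint, ← hint, ← hint,
    ← integral_add_measure (hi _) (hi _), ← integral_add_measure (hi _) (hi _),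
    map_involution_add, integral_smul_measure, extMinkowskiMeasure,
    integral_map hc.measurable.aemeasurable f.continuous.aestronglyMeasurable,
    ENNReal.toReal_ofNat, smul_eq_mul]
  ring

theorem integral_average_iterate_extMinkowskiMeasure (f : C(ProjLine, ℝ)) (n : ℕ) :
    ∫ x, average^[n] f x ∂extMinkowskiMeasure = ∫ x, f x ∂extMinkowskiMeasure := by
  induction n with
  | zero => rfl
  | succ n ih => rw [Function.iterate_succ_apply', integral_average_extMinkowskiMeasure, ih]

/-- A mean of `f` differs from each value of `f` by at most the oscillation. -/
theorem abs_integral_sub_le {f : C(ProjLine, ℝ)} {K : ℝ} (hK : ∀ x y, |f x - f y| ≤ K)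
    (ρ : Measure ProjLine) [IsProbabilityMeasure ρ] (y : ProjLine) :
    |∫ x, f x ∂ρ - f y| ≤ K := by
  have h := norm_integral_le_of_norm_le_const (μ := ρ) (f := fun x => f x - f y)
    (ae_of_all _ fun x => hK x y)
  rw [integral_sub (integrable_of_continuous f ρ) (integrable_const _)] at h
  simpa using h

end Farey

theorem theorem2p4 (π : Measure Farey.ProjLine) [IsProbabilityMeasure π] :
    ∀ f : C(Farey.ProjLine, ℝ),
      Tendsto (fun n : ℕ => ∫ x, f x ∂(Farey.actConv (Farey.convPow Farey.stepMeasure n) π))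
        atTop (𝓝 (∫ x, f x ∂Farey.extMinkowskiMeasure)) := by
  intro f
  rw [Metric.tendsto_atTop]
  intro ε hε
  obtain ⟨C, hC0, hC⟩ := Farey.exists_abs_sub_le f (show 0 < ε / 4 by positivity)
  have hlim : Tendsto (fun n : ℕ => C * Farey.rate ^ n * 2) atTop (𝓝 0) := by
    simpa using ((tendsto_pow_atTop_nhds_zero_of_lt_one (r := Farey.rate)
      (by norm_num [Farey.rate]) (by norm_num [Farey.rate])).const_mul C).mul_const 2
  obtain ⟨N, hN⟩ := (hlim.eventually_lt_const (show 0 < ε / 4 by positivity)).exists_forall_of_atTop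
  refine ⟨N, fun n hn => ?_⟩
  have hosc (x y : Farey.ProjLine) :
      |Farey.average^[n] f x - Farey.average^[n] f y| ≤ ε / 4 + C * Farey.rate ^ n * 2 := by
    refine (Farey.abs_average_iterate_sub_le hC0 hC n x y).trans ?_
    have : 0 ≤ C * Farey.rate ^ n := mul_nonneg hC0 (pow_nonneg (by norm_num [Farey.rate]) n)
    gcongr
    exact Farey.projDist_le_two x y
  have h1 := Farey.abs_integral_sub_le hosc π (Farey.affineChart 0)
  have h2 := Farey.abs_integral_sub_le hosc Farey.extMinkowskiMeasure (Farey.affineChart 0)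
  rw [Farey.integral_average_iterate_extMinkowskiMeasure, abs_sub_comm] at h2
  rw [Farey.integral_actConv_convPow, Real.dist_eq]
  have h3 := abs_sub_le (∫ x, Farey.average^[n] f x ∂π)
    (Farey.average^[n] f (Farey.affineChart 0)) (∫ x, f x ∂Farey.extMinkowskiMeasure)
  linarith [hN n hn]
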